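/- A three counter machine has three counters, each storing a nonnegative integer, and is controlled by a finite sequential program with four types of instructions: increment a counter; conditionally decrement a counter (if its value is positive, subtract $1$ and continue with the next instruction, otherwise leave it unchanged and jump to a specified instruction); unconditional jump; halt. It computes $f:\mathbb N\times\mathbb N\to\mathbb N$ (with $0\in\mathbb N$) in polynomial time if there is a polynomial $p$ such that for all $x,y$ the machine, started at its first instruction with counter contents $x,y,0$, reaches a halt instruction after at most $p(\max(x,y))$ steps with $f(x,y)$ in its first counter. A deterministic one-tape Turing machine, with a finite state set and a finite tape alphabet containing distinct symbols blank, $0$, $1$, $\#$, computes $f$ in linear space if there is a constant $c$ such that for all $x,y$ the machine, started with its head on the blank cell immediately before the first symbol of the word $w=\mathrm{bin}(x)\,\#\,\mathrm{bin}(y)^R$ on an otherwise blank tape, halts with $\mathrm{bin}(f(x,y))$ as its tape contents and its head on the blank cell immediately before the first cell of this word, and during the computation its head stays within distance $c\cdot|w|$ of its initial position. Here $\mathrm{bin}(n)$ is the binary representation of $n$ without leading zeros, most significant bit first ($\mathrm{bin}(0)$ is the empty word), and $u^R$ is the reversal of $u$. **Theorem 1.** The class of functions $f:\mathbb N\times\mathbb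 N\to\mathbb N$ computable by three counter machines in polynomial time coincides with the class of functions $f:\mathbb N\times\mathbb N\to\mathbb N$ computable by deterministic Turing machines in linear space, where input and output of the Turing machines are encoded in binary. -/

import Mathlib

/-! ### Counter machines -/

/-- The four instructions of a `k` counter machine. Instructions are addressed by their position
in the program. -/
inductive CounterInstr (k : ℕ) : Type
  /-- add 1 to counter `i` -/
  | inc (i : Fin k)
  /-- if counter `i` is positive, subtract 1; otherwise leave it unchanged and jump to `target` -/
  | dec (i : Fin k) (target : ℕ)
  | jump (target : ℕ)
  | halt

abbrev CounterProgram (k : ℕ) : Type := List (CounterInstr k)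

structure CounterConfig (k : ℕ) : Type where
  pc : ℕ
  val : Fin k → ℕ

namespace CounterProgram

variable {k : ℕ}

/-- One step. A configuration at a `halt` instruction is left unchanged, and so is one whose
program counter has left the program (the latter does not count as halted, see `Halted`). -/
def step (P : CounterProgram k) (c : CounterConfig k) : CounterConfig k :=
  match P[c.pc]? with
  | some (.inc i) => ⟨c.pc + 1, Function.update c.val i (c.val i + 1)⟩
  | some (.dec i target) =>
      if 0 < c.val i then ⟨c.pc + 1, Function.update c.val i (c.val i - 1)⟩
      else ⟨target, c.val⟩
  | some (.jump target) => ⟨target, c.val⟩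
  | some .halt => c
  | none => c

/-- The machine has stopped: it has reached a `halt` instruction. -/
def Halted (P : CounterProgram k) (c : CounterConfig k) : Prop :=
  P[c.pc]? = some .halt

end CounterProgram

/-- `f` is computable by a three counter machine in polynomial time: started with `x`, `y`, `0` in
its counters, the machine halts with `f x y` in its first counter, after a number of steps that is
polynomially bounded in the larger input value. -/
def ThreeCounterPolyTime (f : ℕ → ℕ → ℕ) : Prop :=
  ∃ (P : CounterProgram 3) (p : Polynomial ℕ), ∀ x y : ℕ, ∃ t : ℕ, t ≤ p.eval (max x y) ∧
    P.Halted (P.step^[t] ⟨0, ![x, y, 0]⟩) ∧ (P.step^[t] ⟨0, ![x, y, 0]⟩).val 0 = f x y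

/-! ### Turing machines -/

/-- The symbols that every tape alphabet contains. -/
inductive BaseSymbol : Type
  | blank
  | zero
  | one
  | sep

/-- Head movements. -/
inductive HeadMove : Type
  | left
  | stay
  | right

def HeadMove.offset : HeadMove → ℤ
  | .left => -1
  | .stay => 0
  | .right => 1

/-- A deterministic Turing machine with one tape, infinite in both directions, with finitely many
states and a finite tape alphabet containing the (distinct) base symbols. It halts when the
transition function is undefined. -/
structure TuringMachine : Type 1 where
  State : Type
  Symbol : Type
  [finiteState : Finite State]
  [finiteSymbol : Finite Symbol]
  base : BaseSymbol ↪ Symbol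
  start : State
  transition : State → Symbol → Option (State × Symbol × HeadMove)

namespace TuringMachine

structure Config (M : TuringMachine) : Type where
  state : M.State
  head : ℤ
  tape : ℤ → M.Symbol

/-- One step; halted configurations are left unchanged. -/
def step (M : TuringMachine) (c : M.Config) : M.Config :=
  match M.transition c.state (c.tape c.head) with
  | some (q, a, d) => ⟨q, c.head + d.offset, Function.update c.tape c.head a⟩
  | none => c

def Halted (M : TuringMachine) (c : M.Config) : Prop :=
  M.transition c.state (c.tape c.head) = none

/-- The tape that carries the word `w` on the cells `h + 1, h + 2, …` and is blank elsewhere, so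
that a head on cell `h` stands immediately before the first symbol of `w`. -/
def tapeOf (M : TuringMachine) (h : ℤ) (w : List BaseSymbol) : ℤ → M.Symbol :=
  fun i => M.base (if h < i then w.getD (i - h - 1).toNat .blank else .blank)

/-- The configuration in which `M` is started on the input word `w`. -/
def init (M : TuringMachine) (w : List BaseSymbol) : M.Config :=
  ⟨M.start, 0, M.tapeOf 0 w⟩

end TuringMachine

/-- The binary representation of `n`, most significant bit first, without leading zeros; the
number `0` has the empty word as its representation. -/
def bin (n : ℕ) : List BaseSymbol :=
  (n.bits.map fun b => if b then BaseSymbol.one else BaseSymbol.zero).reverse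

/-- The input word `bin(x) # bin(y)ᴿ`. -/
def pairInput (x y : ℕ) : List BaseSymbol :=
  bin x ++ BaseSymbol.sep :: (bin y).reverse

/-- `f` is computable by a deterministic Turing machine in linear space: started before the word
`bin(x) # bin(y)ᴿ`, the machine halts with `bin(f(x, y))` as its tape contents and its head before
this word, and its head never gets farther than `c * n` cells from its initial position, where `n`
is the length of the input word and the constant `c` does not depend on the input. -/
def TuringLinearSpace (f : ℕ → ℕ → ℕ) : Prop :=
  ∃ (M : TuringMachine) (c : ℕ), ∀ x y : ℕ,
    (∃ t : ℕ, M.Halted (M.step^[t] (M.init (pairInput x y))) ∧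
      (M.step^[t] (M.init (pairInput x y))).tape =
        M.tapeOf (M.step^[t] (M.init (pairInput x y))).head (bin (f x y))) ∧
    ∀ s : ℕ, |(M.step^[s] (M.init (pairInput x y))).head| ≤ ((c * (pairInput x y).length : ℕ) : ℤ)

/-! Put `m = max x y` and let `n` be the length of the input word. Powers with exponent linear in
`n` are bounded by polynomials in `m`, and every polynomial in `m` is below `2 ^ (C * n)` for some
`C`. So polynomially bounded counters and linearly long tape contents are the same resource.

From counters to tape: within `p(m)` steps no counter exceeds `m + p(m)`, so its binary expansion
has `O(n)` bits. The word `bin(x) # bin(y)ᴿ` is already a tape with two binary counters growing away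
from the separator, and the third counter occupies a second track. An instruction is one walk
outward, carrying or borrowing, and one walk back (`CounterToTuring.represents_step`). At the end
everything except counter `0` is erased, and so are its leading zeros
(`CounterToTuring.exists_halted`).

From tape to counters: with the blank coded by `0`, the tape to the left of the head and the rest of
it are two numbers in base `K`, and a Turing step consists of pushes and pops, that is,
multiplications and divisions by `K` with the third counter as scratch space
(`TuringToCounter.Encodes.step`). A marker digit lets the same three counters convert the binary
input (`TuringToCounter.reaches_input`).

In this direction no running time is computed. All counters stay below some `V` polynomial in `m`,
and a deterministic run to a given configuration can be cut to one without repetitions, so its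
length is at most the number of configurations, which is polynomial (`Reaches.exists_le_card`,
`GraphInstr.compile_halts`). Hence the simulations only have to show that a run reaches its goal
inside a given set. This is the relation `Reaches`; the set expresses the space bound in one
direction and the bound on the counters in the other. -/

/-! ### Reachability inside a set of configurations -/

/-- Iterating `f` leads from `a` to `b` without leaving `S`. -/
def Reaches {α : Type*} (f : α → α) (S : Set α) (a b : α) : Prop :=
  ∃ t, f^[t] a = b ∧ ∀ s ≤ t, f^[s] a ∈ S

namespace Reaches

variable {α β : Type*} {f : α → α} {S : Set α} {a b c : α}

theorem refl (h : a ∈ S) : Reaches f S a a :=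
  ⟨0, rfl, fun s hs => by obtain rfl : s = 0 := by omega
                          exact h⟩

theorem head (h : a ∈ S) (hb : Reaches f S (f a) b) : Reaches f S a b := by
  obtain ⟨t, ht, hS⟩ := hb
  refine ⟨t + 1, ht, fun s hs => ?_⟩
  cases s with
  | zero => exact h
  | succ s => exact hS s (by omega)

theorem head_eq (h : a ∈ S) (e : f a = c) (hb : Reaches f S c b) : Reaches f S a b :=
  head h (e ▸ hb)

theorem trans (h₁ : Reaches f S a b) (h₂ : Reaches f S b c) : Reaches f S a c := by
  obtain ⟨t, ht, hS⟩ := h₁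
  induction t generalizing a with
  | zero => obtain rfl : a = b := ht
            exact h₂
  | succ t ih =>
    exact head (hS 0 (by omega)) (ih ht fun s hs => hS (s + 1) (by omega))

theorem left_mem (h : Reaches f S a b) : a ∈ S := by
  obtain ⟨t, -, hS⟩ := h
  exact hS 0 (by omega)

/-- A step-by-step simulation extends to whole runs. -/
theorem simulate {g : β → β} {T : Set β} {R : β → α → Prop}
    (hR : ∀ x ∈ T, g x ∈ T → ∀ y, R x y → ∃ y', R (g x) y' ∧ Reaches f S y y')
    (h₀ : ∀ x ∈ T, ∀ y, R x y → y ∈ S)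
    {x x' : β} (h : Reaches g T x x') {y : α} (hxy : R x y) :
    ∃ y', R x' y' ∧ Reaches f S y y' := by
  obtain ⟨t, ht, hT⟩ := h
  induction t generalizing x y with
  | zero =>
    obtain rfl : x = x' := ht
    exact ⟨y, hxy, refl (h₀ x (hT 0 le_rfl) y hxy)⟩
  | succ t ih =>
    obtain ⟨y₁, h₁, r₁⟩ := hR x (hT 0 (by omega)) (hT 1 (by omega)) y hxy
    obtain ⟨y₂, h₂, r₂⟩ := ih h₁ ht (fun s hs => hT (s + 1) (by omega))
    exact ⟨y₂, h₂, r₁.trans r₂⟩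

/-- Nothing moves after a fixed point, so a bound valid along the finite run is valid at all times,
as the definition of linear space demands. -/
theorem forall_iterate_mem (h : Reaches f S a b) (hb : f b = b) (s : ℕ) : f^[s] a ∈ S := by
  obtain ⟨t, ht, hS⟩ := h
  rcases le_total s t with hs | hs
  · exact hS s hs
  · obtain ⟨r, rfl⟩ := Nat.exists_eq_add_of_le' hs
    rw [Function.iterate_add_apply, ht, Function.iterate_fixed hb, ← ht]
    exact hS t le_rfl

/-- A deterministic run that reaches `b` inside a finite set does so within as many steps as
the set has elements. -/
theorem exists_le_card {F : Finset α} (h : Reaches f (F : Set α) a b) :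
    ∃ t ≤ F.card, f^[t] a = b := by
  classical
  have hex : ∃ t, f^[t] a = b ∧ ∀ s ≤ t, f^[s] a ∈ F := by simpa [Reaches] using h
  obtain ⟨t, ⟨ht, hF⟩, hmin⟩ :
      ∃ t, (f^[t] a = b ∧ ∀ s ≤ t, f^[s] a ∈ F) ∧
        ∀ t' < t, ¬ (f^[t'] a = b ∧ ∀ s ≤ t', f^[s] a ∈ F) :=
    ⟨Nat.find hex, Nat.find_spec hex, fun t' h' => Nat.find_min hex h'⟩
  refine ⟨t, ?_, ht⟩
  have key : ∀ i j, i < j → j ≤ t → f^[i] a ≠ f^[j] a := by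
    intro i j hij hj e
    -- Cutting out the loop between times `i` and `j` would reach `b` earlier than the minimal time.
    refine hmin (t - j + i) (by omega) ⟨?_, fun s hs => hF s (by omega)⟩
    rw [Function.iterate_add_apply, e, ← Function.iterate_add_apply, Nat.sub_add_cancel hj, ht]
  have := Finset.card_le_card_of_injOn (s := Finset.range t) (t := F) (fun s => f^[s] a)
    (fun s hs => hF s (by simp at hs; omega)) (by
      intro i hi j hj e
      simp only [Finset.coe_range, Set.mem_Iio] at hi hj
      rcases lt_trichotomy i j with h | h | h
      · exact absurd e (key i j h (by omega))
      · exact h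
      · exact absurd e.symm (key j i h (by omega)))
  simpa using this

end Reaches

/-! ### Binary representations -/

/-- The value of a list of bits, least significant bit first. -/
def bitsValue (l : List Bool) : ℕ := l.foldr (fun b n => 2 * n + b.toNat) 0

@[simp] theorem bitsValue_nil : bitsValue [] = 0 := rfl

@[simp] theorem bitsValue_cons (b : Bool) (l : List Bool) :
    bitsValue (b :: l) = 2 * bitsValue l + b.toNat := rfl

theorem bits_eq_cons {n : ℕ} (hn : n ≠ 0) : n.bits = (n % 2 == 1) :: (n / 2).bits := by
  conv_lhs => rw [← Nat.bit_bodd_div2 n]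
  rw [Nat.bits_append_bit]
  · simp [Nat.div2_val, Nat.mod_two_of_bodd]
  · intro h
    have := Nat.bodd_add_div2 n
    by_contra hb
    simp [h, Bool.eq_false_iff.mpr hb] at this
    omega

theorem bitsValue_bits (n : ℕ) : bitsValue n.bits = n := by
  induction n using Nat.strong_induction_on with
  | _ n ih =>
    rcases eq_or_ne n 0 with rfl | hn
    · simp
    · rw [bits_eq_cons hn, bitsValue_cons, ih _ (by omega)]
      rcases Nat.mod_two_eq_zero_or_one n with h | h <;> simp [h] <;> omega

/-- A list whose most significant bit is `true` is canonical. The nonvanishing of the value is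
carried along because the recursion for `Nat.bits` requires it. -/
theorem bits_bitsValue (l : List Bool) (h : ∀ hl : l ≠ [], l.getLast hl = true) :
    (bitsValue l).bits = l ∧ (l ≠ [] → bitsValue l ≠ 0) := by
  induction l with
  | nil => simp
  | cons b l ih =>
    have ih' := ih fun hl => by simpa [List.getLast_cons hl] using h (by simp)
    have hne : bitsValue (b :: l) ≠ 0 := by
      rcases eq_or_ne l [] with rfl | hl
      · have : b = true := by simpa using h (by simp)
        simp [this]
      · have := ih'.2 hl
        simp only [bitsValue_cons]
        omega
    refine ⟨?_, fun _ => hne⟩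
    rw [bits_eq_cons hne]
    have h2 : (2 * bitsValue l + b.toNat) / 2 = bitsValue l := by cases b <;> simp; omega
    have h3 : ((2 * bitsValue l + b.toNat) % 2 == 1) = b := by
      cases b <;> simp
    simp only [bitsValue_cons, h2, h3, ih'.1]

theorem bitsValue_replicate_false_append (j : ℕ) (l : List Bool) :
    bitsValue (List.replicate j false ++ l) = 2 ^ j * bitsValue l := by
  induction j with
  | zero => simp
  | succ j ih => simp [List.replicate_succ, ih]; ring

/-- Together with the previous lemma this is the arithmetic of carry and borrow: adding one to `j`
ones followed by `l` gives `j` zeros followed by the successor of `l`. -/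
theorem bitsValue_replicate_true_append (j : ℕ) (l : List Bool) :
    bitsValue (List.replicate j true ++ l) + 1 = 2 ^ j * (bitsValue l + 1) := by
  induction j with
  | zero => simp
  | succ j ih => simp [List.replicate_succ]; rw [pow_succ]; linarith

theorem bitsValue_append (l₁ l₂ : List Bool) :
    bitsValue (l₁ ++ l₂) = bitsValue l₁ + 2 ^ l₁.length * bitsValue l₂ := by
  induction l₁ with
  | nil => simp
  | cons b l ih => simp [ih]; ring

theorem two_pow_length_bits_le (n : ℕ) : 2 ^ n.bits.length ≤ 2 * n + 1 := by
  have key : ∀ n, n ≠ 0 → 2 ^ n.bits.length ≤ 2 * n := by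
    intro n
    induction n using Nat.strong_induction_on with
    | _ n ih =>
      intro hn
      rw [bits_eq_cons hn, List.length_cons, pow_succ]
      rcases eq_or_ne (n / 2) 0 with h | h
      · simp [h]; omega
      · have := ih (n / 2) (by omega) h
        omega
  rcases eq_or_ne n 0 with rfl | hn
  · simp
  · exact (key n hn).trans (by omega)

/-- The natural number `q`, cut off at `n`. -/
def cap (n q : ℕ) : Fin (n + 1) := ⟨min q n, by omega⟩

theorem cap_val {n q : ℕ} (h : q ≤ n) : (cap n q : ℕ) = q := min_eq_left h

/-! ### Simulating a three counter machine on a Turing machine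

The separator of the input word serves as the centre of the tape. Counter `0` is stored to the left
of the centre, counters `1` and `2` on two tracks to the right of it, each with its least
significant bit next to the centre. -/

namespace CounterToTuring

/-- The centre (`none`), or a cell with two tracks. -/
abbrev TrackSymbol : Type := Option (Option Bool × Option Bool)

/-- `scan i b q z` skips bits `b` of counter `i`; `q` and `z` are the program positions to continue
at after a change and after finding the value zero. `back i b q` writes `b` on every cell on the way
to the centre. The states from `findRight` on prepare the output. -/
inductive SimState (n : ℕ) : Type
  | seek
  | run (q : Fin (n + 1))
  | scan (i : Fin 3) (b : Bool) (q z : Fin (n + 1))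
  | back (i : Fin 3) (b : Bool) (q : Fin (n + 1))
  | findRight
  | eraseBack
  | findLeft
  | eraseZeros
  | done
  deriving Fintype

def getTrack (i : Fin 3) (c : Option Bool × Option Bool) : Option Bool :=
  if i = 2 then c.2 else c.1

def setTrack (i : Fin 3) (b : Bool) (c : Option Bool × Option Bool) : Option Bool × Option Bool :=
  if i = 2 then (c.1, some b) else (some b, c.2)

def outward (i : Fin 3) : HeadMove := if i = 0 then .left else .right

def inward (i : Fin 3) : HeadMove := if i = 0 then .right else .left

/-- With the least significant bit first, an increment turns a prefix `1…10` into `0…01` and a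
decrement turns `0…01` into `1…10`, so one scan serves both with the bits exchanged. They differ
only at the end of the list: an increment appends a bit there, while a decrement has found the value
zero. -/
def transition (P : CounterProgram 3) : SimState P.length → TrackSymbol →
    Option (SimState P.length × TrackSymbol × HeadMove)
  | .seek, none => some (.run (cap _ 0), none, .stay)
  | .seek, some c => some (.seek, some c, .right)
  | .run q, none =>
    match P[q.val]? with
    | some (.inc i) => some (.scan i true (cap _ (q + 1)) (cap _ (q + 1)), none, outward i)
    | some (.dec i t) => some (.scan i false (cap _ (q + 1)) (cap _ t), none, outward i)
    | some (.jump t) => some (.run (cap _ t), none, .stay)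
    | some .halt => some (.findRight, none, .right)
    | none => none
  | .scan i b q z, some c =>
    match getTrack i c with
    | some b' =>
      if b' = b then some (.scan i b q z, some c, outward i)
      else some (.back i (!b) q, some (setTrack i b c), inward i)
    | none =>
      if b then some (.back i false q, some (setTrack i true c), inward i)
      else some (.back i false z, some c, inward i)
  | .back i b q, some c => some (.back i b q, some (setTrack i b c), inward i)
  | .back _ _ q, none => some (.run q, none, .stay)
  | .findRight, some c =>
    if c = (none, none) then some (.eraseBack, some c, .left) else some (.findRight, some c, .right)
  | .eraseBack, some _ => some (.eraseBack, some (none, none), .left)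
  | .eraseBack, none => some (.findLeft, some (none, none), .left)
  | .findLeft, some (some b, o) => some (.findLeft, some (some b, o), .left)
  | .findLeft, some (none, o) => some (.eraseZeros, some (none, o), .right)
  | .eraseZeros, some (some false, _) => some (.eraseZeros, some (none, none), .right)
  | .eraseZeros, some (some true, o) => some (.done, some (some true, o), .left)
  | _, _ => none

def baseSymbol : BaseSymbol ↪ TrackSymbol where
  toFun
    | .blank => some (none, none)
    | .zero => some (some false, none)
    | .one => some (some true, none)
    | .sep => none
  inj' := by intro a b h; cases a <;> cases b <;> simp_all

/-- The Turing machine that simulates the counter program `P`. -/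
def machine (P : CounterProgram 3) : TuringMachine where
  State := SimState P.length
  Symbol := TrackSymbol
  base := baseSymbol
  start := .seek
  transition := transition P

/-- The tape with symbol `s` on cell `p` and the bits of the three counters around it. -/
def tape (s : TrackSymbol) (p : ℤ) (l : Fin 3 → List Bool) (z : ℤ) : TrackSymbol :=
  if z = p then s
  else if z < p then some ((l 0)[(p - 1 - z).toNat]?, none)
  else some ((l 1)[(z - p - 1).toNat]?, (l 2)[(z - p - 1).toNat]?)

theorem outward_offset (i : Fin 3) : (outward i).offset = if i = 0 then -1 else 1 := by
  unfold outward; split_ifs <;> rfl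

theorem inward_offset (i : Fin 3) : (inward i).offset = -(outward i).offset := by
  unfold outward inward; split_ifs <;> rfl

/-! ### Bit lists on the tape -/

section Tape

variable {s : TrackSymbol} {p : ℤ} {l : Fin 3 → List Bool}

@[simp] theorem tape_center : tape s p l p = s := by simp [tape]

/-- Sides and tracks are hidden behind `outward` and `getTrack`, so that the walks below treat all
three counters alike. -/
theorem tape_cell (i : Fin 3) (j : ℕ) : ∃ c, tape s p l (p + (outward i).offset * (j + 1)) = some c ∧
    getTrack i c = (l i)[j]? := by
  rw [outward_offset]
  unfold tape getTrack
  have h1 : p + (j + 1 : ℤ) ≠ p := by omega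
  have h2 : ¬ p + (j + 1 : ℤ) < p := by omega
  have h4 : p - (j + 1 : ℤ) ≠ p := by omega
  have h5 : p - (j + 1 : ℤ) < p := by omega
  have h6 : (p - 1 - (p - (j + 1 : ℤ))).toNat = j := by omega
  fin_cases i
  · exact ⟨((l 0)[j]?, none), by simp [← sub_eq_add_neg, -neg_add_rev, h4, h5], by simp⟩
  · exact ⟨((l 1)[j]?, (l 2)[j]?), by simp [h1, h2], by simp⟩
  · exact ⟨((l 1)[j]?, (l 2)[j]?), by simp [h1, h2], by simp⟩

/-- Writing a bit on a track amounts to changing the corresponding list. -/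
theorem update_tape {i : Fin 3} {j : ℕ} {b : Bool} {c : Option Bool × Option Bool} {m : List Bool}
    (hc : tape s p l (p + (outward i).offset * (j + 1)) = some c)
    (hm : ∀ k, m[k]? = if k = j then some b else (l i)[k]?) :
    Function.update (tape s p l) (p + (outward i).offset * (j + 1)) (some (setTrack i b c)) =
      tape s p (Function.update l i m) := by
  rw [outward_offset] at *
  funext z
  rcases eq_or_ne z (p + (if i = 0 then -1 else 1) * (j + 1)) with rfl | hz
  · rw [Function.update_self]
    revert hc
    unfold tape setTrack
    have h1 : p + (j + 1 : ℤ) ≠ p := by omega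
    have h2 : ¬ p + (j + 1 : ℤ) < p := by omega
    have h4 : p - (j + 1 : ℤ) ≠ p := by omega
    have h5 : p - (j + 1 : ℤ) < p := by omega
    have h6 : (p - 1 - (p - (j + 1 : ℤ))).toNat = j := by omega
    fin_cases i
    · simp only [Fin.zero_eta, if_true, neg_mul, one_mul, ← sub_eq_add_neg, h4, h5, h6, if_false]
      rintro h; cases h; simp [hm]
    · simp [h1, h2]
      rintro rfl; simp [hm]
    · simp [h1, h2]
      rintro rfl; simp [hm]
  · rw [Function.update_of_ne hz]
    unfold tape
    split_ifs with h1 h2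
    · rfl
    · fin_cases i
      · have : (p - 1 - z).toNat ≠ j := by simp at hz; omega
        simp [hm, this]
      · simp
      · simp
    · fin_cases i
      · simp
      · have : (z - p - 1).toNat ≠ j := by simp at hz; omega
        simp only [Fin.mk_one] at hm
        have e : m[(z - p - 1).toNat]? = (l 1)[(z - p - 1).toNat]? := by rw [hm, if_neg this]
        simpa using e.symm
      · have : (z - p - 1).toNat ≠ j := by simp at hz; omega
        simp only [Fin.reduceFinMk] at hm
        have e : m[(z - p - 1).toNat]? = (l 2)[(z - p - 1).toNat]? := by rw [hm, if_neg this]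
        simpa using e.symm

theorem update_tape_center (s' : TrackSymbol) :
    Function.update (tape s p l) p s' = tape s' p l := by
  funext z
  rcases eq_or_ne z p with rfl | hz
  · simp
  · simp [hz, tape]

theorem update_tape_self (z : ℤ) {c : TrackSymbol} (h : tape s p l z = c) :
    Function.update (tape s p l) z c = tape s p l := by
  rw [← h, Function.update_eq_self]

end Tape

/-! ### Simulating one counter instruction -/

variable {P : CounterProgram 3} {B : ℕ} {p : ℤ}

/-- The configurations whose head is at distance at most `B` from the cell `0`. -/
def near (P : CounterProgram 3) (B : ℕ) : Set (machine P).Config := {c | |c.head| ≤ B}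

/-- A configuration of the simulating machine. -/
def conf (P : CounterProgram 3) (q : SimState P.length) (h : ℤ) (t : ℤ → TrackSymbol) :
    (machine P).Config := ⟨q, h, t⟩

theorem reaches_step {q q' : SimState P.length} {h : ℤ} {t : ℤ → TrackSymbol} {a : TrackSymbol}
    {d : HeadMove} {c : (machine P).Config} (hB : |h| ≤ B)
    (htr : transition P q (t h) = some (q', a, d))
    (hr : Reaches (machine P).step (near P B) (conf P q' (h + d.offset) (Function.update t h a)) c) :
    Reaches (machine P).step (near P B) (conf P q h t) c := by
  refine Reaches.head_eq hB ?_ hr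
  have : (machine P).transition q (t h) = some (q', a, d) := htr
  simp [TuringMachine.step, conf, this]
  rfl

theorem reaches_self {q : SimState P.length} {h : ℤ} {t : ℤ → TrackSymbol} (hB : |h| ≤ B) :
    Reaches (machine P).step (near P B) (conf P q h t) (conf P q h t) := Reaches.refl hB

/-- The head position `j` cells away from the centre on the side of counter `i`. -/
def pos (p : ℤ) (i : Fin 3) (j : ℕ) : ℤ := p + (outward i).offset * j

theorem abs_pos_le {L j : ℕ} (hB : |p| + L ≤ B) (hj : j ≤ L) (i : Fin 3) : |pos p i j| ≤ B := by
  unfold pos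
  rw [outward_offset]
  split_ifs <;> simp only [abs_le] at * <;>
    rcases abs_cases p with h | h <;> omega

theorem pos_succ_add_inward (i : Fin 3) (j : ℕ) : pos p i (j + 1) + (inward i).offset = pos p i j := by
  rw [inward_offset]; unfold pos; push_cast; ring

theorem pos_add_outward (i : Fin 3) (j : ℕ) : pos p i j + (outward i).offset = pos p i (j + 1) := by
  unfold pos; push_cast; ring

theorem getElem?_append_cons_of {pre r : List Bool} {x b : Bool} (k : ℕ) :
    (pre ++ b :: r)[k]? = if k = pre.length then some b else (pre ++ x :: r)[k]? := by
  rcases lt_trichotomy k pre.length with h | h | h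
  · rw [List.getElem?_append_left h, List.getElem?_append_left h, if_neg h.ne]
  · simp [h]
  · obtain ⟨m, hm⟩ : ∃ m, k - pre.length = m + 1 := ⟨k - pre.length - 1, by omega⟩
    rw [List.getElem?_append_right h.le, List.getElem?_append_right h.le, hm, if_neg h.ne']
    simp

/-- The head meets the last bit of `m` first, hence the induction from the outer end; each rewritten
bit moves from `m` to `r`. -/
theorem reaches_back {L : ℕ} (hB : |p| + L ≤ B) (i : Fin 3) (b : Bool) (q : Fin (P.length + 1))
    (m r : List Bool) (l : Fin 3 → List Bool) (hl : l i = m ++ r) (hm : m.length ≤ L) :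
    Reaches (machine P).step (near P B) (conf P (.back i b q) (pos p i m.length) (tape none p l))
      (conf P (.run q) p
        (tape none p (Function.update l i (List.replicate m.length b ++ r)))) := by
  induction m using List.reverseRecOn generalizing l r with
  | nil =>
    have hp : pos p i 0 = p := by simp [pos]
    have hpB : |p| ≤ B := by omega
    refine reaches_step (q' := .run q) (a := none) (d := .stay) ?_ ?_ ?_
    · simpa [hp] using hpB
    · simp [hp, transition]
    · simp only [List.length_nil, hp, update_tape_center, List.replicate_zero, List.nil_append]
      rw [List.nil_append] at hl
      rw [← hl, Function.update_eq_self]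
      simpa [HeadMove.offset] using reaches_self hpB
  | append_singleton m x ih =>
    simp only [List.length_append, List.length_singleton] at hm ⊢
    obtain ⟨c, hc, hg⟩ := tape_cell (s := none) (p := p) (l := l) i m.length
    have hc' : tape none p l (pos p i (m.length + 1)) = some c := by
      simpa [pos] using hc
    refine reaches_step (q' := .back i b q) (a := some (setTrack i b c)) (d := inward i)
      (abs_pos_le hB hm i) ?_ ?_
    · rw [hc']; rfl
    · rw [pos_succ_add_inward]
      have hu : Function.update (tape none p l) (pos p i (m.length + 1)) (some (setTrack i b c)) =
          tape none p (Function.update l i (m ++ b :: r)) := by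
        have := update_tape (b := b) (m := m ++ b :: r) hc (by
          intro k
          rw [hl, List.append_assoc]
          exact getElem?_append_cons_of k)
        simpa [pos] using this
      rw [hu]
      have := ih (b :: r) (Function.update l i (m ++ b :: r)) (by simp) (by omega)
      simpa [List.replicate_succ', List.append_assoc] using this

/-- Scanning over a block of bits `b`. -/
theorem reaches_scan {L : ℕ} (hB : |p| + L ≤ B) (i : Fin 3) (b : Bool) (q z : Fin (P.length + 1))
    (n j : ℕ) (r : List Bool) (l : Fin 3 → List Bool) (hl : l i = List.replicate (j + n) b ++ r)
    (hj : j + n + 1 ≤ L) {c : (machine P).Config}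
    (hr : Reaches (machine P).step (near P B)
      (conf P (.scan i b q z) (pos p i (j + n + 1)) (tape none p l)) c) :
    Reaches (machine P).step (near P B)
      (conf P (.scan i b q z) (pos p i (j + 1)) (tape none p l)) c := by
  induction n generalizing j with
  | zero => exact hr
  | succ n ih =>
    obtain ⟨c', hc, hg⟩ := tape_cell (s := none) (p := p) (l := l) i j
    have hc' : tape none p l (pos p i (j + 1)) = some c' := by simpa [pos] using hc
    refine reaches_step (q' := .scan i b q z) (a := some c') (d := outward i)
      (abs_pos_le hB (by omega) i) ?_ ?_
    · have : (l i)[j]? = some b := by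
        rw [hl, List.getElem?_append_left (by simp)]
        simp
      rw [this] at hg
      rw [hc']
      simp [transition, hg]
    · rw [pos_add_outward, update_tape_self _ hc']
      exact ih (j + 1) (by rw [hl]; congr 2; omega) (by omega)
        (by convert hr using 4; omega)

theorem exists_replicate_append (b : Bool) (l : List Bool) :
    ∃ n r, l = List.replicate n b ++ r ∧ (r = [] ∨ ∃ r', r = (!b) :: r') := by
  induction l with
  | nil => exact ⟨0, [], by simp⟩
  | cons x l ih =>
    by_cases h : x = b
    · obtain ⟨n, r, hr, h'⟩ := ih
      exact ⟨n + 1, r, by simp [List.replicate_succ, h, hr], h'⟩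
    · exact ⟨0, x :: l, by simp, Or.inr ⟨l, by cases x <;> cases b <;> simp_all⟩⟩

/-- The effect of a scan followed by the way back. -/
theorem reaches_scan_back {L : ℕ} (hB : |p| + (L + 1 : ℕ) ≤ B) (i : Fin 3) (b : Bool)
    (q z : Fin (P.length + 1)) (n : ℕ) (r : List Bool) (l : Fin 3 → List Bool)
    (hl : l i = List.replicate n b ++ r) (hlen : (l i).length ≤ L) :
    ((∃ r', r = (!b) :: r') ∨ (r = [] ∧ b = true) →
      Reaches (machine P).step (near P B) (conf P (.scan i b q z) (pos p i 1) (tape none p l))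
        (conf P (.run q) p (tape none p
          (Function.update l i (List.replicate n (!b) ++ b :: r.tail))))) ∧
    (r = [] ∧ b = false →
      Reaches (machine P).step (near P B) (conf P (.scan i b q z) (pos p i 1) (tape none p l))
        (conf P (.run z) p (tape none p l))) := by
  have hn : n ≤ L := by
    have := hlen
    rw [hl] at this
    simp at this
    omega
  obtain ⟨c, hc, hg⟩ := tape_cell (s := none) (p := p) (l := l) i n
  have hc' : tape none p l (pos p i (n + 1)) = some c := by simpa [pos] using hc
  have hgr : (l i)[n]? = r[0]? := by
    rw [hl, List.getElem?_append_right (by simp)]; simp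
  constructor
  · intro h
    refine reaches_scan hB i b q z n 0 r l (by simpa using hl) (by omega) ?_
    rw [Nat.zero_add]
    refine reaches_step (q' := .back i (!b) q) (a := some (setTrack i b c)) (d := inward i)
      (abs_pos_le hB (by omega) i) ?_ ?_
    · rw [hc']
      rcases h with ⟨r', rfl⟩ | ⟨rfl, rfl⟩
      · have : getTrack i c = some (!b) := by rw [hg, hgr]; rfl
        simp [transition, this]
      · have : getTrack i c = none := by rw [hg, hgr]; rfl
        simp [transition, this]
    · rw [pos_succ_add_inward]
      have hu := update_tape (b := b) (m := List.replicate n b ++ b :: r.tail) hc (by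
        intro k
        rw [hl]
        rcases h with ⟨r', rfl⟩ | ⟨rfl, rfl⟩
        · simpa using getElem?_append_cons_of (pre := List.replicate n b) (r := r') (x := !b)
            (b := b) k
        · rw [List.getElem?_append, List.getElem?_append]
          split_ifs with h1 h2 h2
          · simp at h1; omega
          · rfl
          · simp [h2]
          · simp at h1
            obtain ⟨m, hm⟩ : ∃ m, k - n = m + 1 := ⟨k - n - 1, by omega⟩
            simp [hm])
      have hu' : Function.update (tape none p l) (pos p i (n + 1)) (some (setTrack i b c)) =
          tape none p (Function.update l i (List.replicate n b ++ b :: r.tail)) := by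
        simpa [pos] using hu
      rw [hu']
      have := reaches_back (P := P) (p := p) hB i (!b) q (List.replicate n b) (b :: r.tail)
        (Function.update l i (List.replicate n b ++ b :: r.tail)) (by simp) (by simp; omega)
      simpa using this
  · rintro ⟨rfl, rfl⟩
    refine reaches_scan hB i false q z n 0 [] l (by simpa using hl) (by omega) ?_
    rw [Nat.zero_add]
    refine reaches_step (q' := .back i false z) (a := some c) (d := inward i)
      (abs_pos_le hB (by omega) i) ?_ ?_
    · rw [hc']
      have : getTrack i c = none := by rw [hg, hgr]; rfl
      simp [transition, this]
    · rw [pos_succ_add_inward, update_tape_self _ hc']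
      -- The scan has passed only zeros, so the zeros written on the way back change nothing.
      have := reaches_back (P := P) (p := p) hB i false z (List.replicate n false) [] l hl
        (by simp; omega)
      simp only [List.length_replicate, ← hl, Function.update_eq_self] at this
      exact this

/-- The Turing machine configuration `d` represents the counter configuration `c`, with the centre
on cell `p` and at most `L` bits for each counter. -/
def Represents (p : ℤ) (L : ℕ) (c : CounterConfig 3) (d : (machine P).Config) : Prop :=
  ∃ l : Fin 3 → List Bool, (∀ i, bitsValue (l i) = c.val i ∧ (l i).length ≤ L) ∧
    d = conf P (.run (cap _ c.pc)) p (tape none p l)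

/-- All addresses outside the program are merged into `P.length`, where there is no instruction
either; this keeps the state set finite. -/
theorem getElem?_cap (q : ℕ) : P[(cap P.length q).val]? = P[q]? := by
  unfold cap
  rcases le_total q P.length with h | h
  · simp [h]
  · rw [List.getElem?_eq_none (by simpa using h)]
    simp [h]

theorem cap_val_succ {q : ℕ} (h : q < P.length) : (cap P.length q).val + 1 = q + 1 := by
  simp [cap, h.le]

/-- Lists may carry leading zeros, since a decrement never shortens them. The spare cell in `L + 1`
is the empty one at which a scan over a full list turns around. -/
theorem represents_step {L : ℕ} (hB : |p| + (L + 1 : ℕ) ≤ B) {c : CounterConfig 3}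
    (hc : ∀ i, (P.step c).val i < 2 ^ L) {d : (machine P).Config} (h : Represents p L c d) :
    ∃ d', Represents p L (P.step c) d' ∧
      Reaches (machine P).step (near P B) d d' := by
  obtain ⟨l, hl, rfl⟩ := h
  have hpB : |p| ≤ B := by omega
  rcases hP : P[c.pc]? with _ | (i | ⟨i, t⟩ | t | _)
  · have : P.step c = c := by simp [CounterProgram.step, hP]
    rw [this]
    exact ⟨_, ⟨l, hl, rfl⟩, reaches_self hpB⟩
  · have hlt : c.pc < P.length := (List.getElem?_eq_some_iff.mp hP).1
    have hstep : P.step c = ⟨c.pc + 1, Function.update c.val i (c.val i + 1)⟩ := by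
      simp [CounterProgram.step, hP]
    obtain ⟨n, r, hr, hr'⟩ := exists_replicate_append true (l i)
    have hr2 : (∃ r', r = (!true) :: r') ∨ (r = [] ∧ true = true) := by tauto
    rw [hstep] at hc
    rw [hstep]
    have hval : bitsValue (List.replicate n false ++ true :: r.tail) = c.val i + 1 := by
      rw [← (hl i).1, hr, bitsValue_replicate_true_append, bitsValue_replicate_false_append]
      rcases hr' with rfl | ⟨r', rfl⟩ <;> simp
    refine ⟨_, ⟨Function.update l i (List.replicate n false ++ true :: r.tail), ?_, rfl⟩, ?_⟩
    · intro k
      rcases eq_or_ne k i with rfl | hk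
      · simp only [Function.update_self]
        refine ⟨hval, ?_⟩
        have hc := hc k
        rcases hr' with rfl | ⟨r', rfl⟩
        -- The list grows only here: it consisted of `n` ones, the new value is `2 ^ n`, and `2 ^ n
        -- < 2 ^ L` leaves room for the additional bit.
        · simp only [Function.update_self] at hc
          rw [← hval, bitsValue_replicate_false_append] at hc
          simp at hc
          rw [Nat.pow_lt_pow_iff_right (by omega)] at hc
          simpa using hc
        · have := (hl k).2
          rw [hr] at this
          simpa using this
      · simpa [hk] using hl k
    · refine reaches_step (q' := .scan i true (cap _ (c.pc + 1)) (cap _ (c.pc + 1))) (a := none)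
        (d := outward i) hpB ?_ ?_
      · simp [transition, getElem?_cap, hP, cap_val_succ hlt]
      · rw [update_tape_center]
        have := (reaches_scan_back (P := P) (p := p) hB i true (cap _ (c.pc + 1))
          (cap _ (c.pc + 1)) n r l hr (hl i).2).1 hr2
        simpa [pos] using this
  · have hlt : c.pc < P.length := (List.getElem?_eq_some_iff.mp hP).1
    obtain ⟨n, r, hr, hr'⟩ := exists_replicate_append false (l i)
    have hstart : transition P (.run (cap _ c.pc)) (tape none p l p) =
        some (.scan i false (cap _ (c.pc + 1)) (cap _ t), none, outward i) := by
      simp [transition, getElem?_cap, hP, cap_val_succ hlt]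
    have hv : c.val i = 2 ^ n * bitsValue r := by
      rw [← (hl i).1, hr, bitsValue_replicate_false_append]
    have hscan := reaches_scan_back (P := P) (p := p) hB i false (cap _ (c.pc + 1))
          (cap _ t) n r l hr (hl i).2
    rcases hr' with rfl | ⟨r', rfl⟩
    · have hstep : P.step c = ⟨t, c.val⟩ := by
        have : c.val i = 0 := by simpa using hv
        simp [CounterProgram.step, hP, this]
      rw [hstep]
      refine ⟨_, ⟨l, hl, rfl⟩, reaches_step hpB hstart ?_⟩
      rw [update_tape_center]
      simpa [pos] using hscan.2 ⟨rfl, rfl⟩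
    · have hval : bitsValue (List.replicate n true ++ false :: r') + 1 = c.val i := by
        rw [hv, bitsValue_replicate_true_append]; simp
      have hstep : P.step c = ⟨c.pc + 1, Function.update c.val i (c.val i - 1)⟩ := by
        have : 0 < c.val i := by omega
        simp [CounterProgram.step, hP, this]
      rw [hstep]
      refine ⟨_, ⟨Function.update l i (List.replicate n true ++ false :: r'), ?_, rfl⟩,
        reaches_step hpB hstart ?_⟩
      · intro k
        rcases eq_or_ne k i with rfl | hk
        · simp only [Function.update_self]
          refine ⟨by omega, ?_⟩
          have := (hl k).2
          rw [hr] at this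
          simpa using this
        · simpa [hk] using hl k
      · rw [update_tape_center]
        simpa [pos] using hscan.1 (Or.inl ⟨r', rfl⟩)
  · have hstep : P.step c = ⟨t, c.val⟩ := by simp [CounterProgram.step, hP]
    rw [hstep]
    refine ⟨_, ⟨l, hl, rfl⟩, reaches_step (q' := .run (cap _ t)) (a := none) (d := .stay)
      hpB ?_ ?_⟩
    · simp [transition, getElem?_cap, hP]
    · rw [update_tape_center]
      simpa [HeadMove.offset] using reaches_self hpB
  · have : P.step c = c := by simp [CounterProgram.step, hP]
    rw [this]
    exact ⟨_, ⟨l, hl, rfl⟩, reaches_self hpB⟩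

/-! ### Cleaning the tape and producing the output -/

theorem tape_right {s : TrackSymbol} {l : Fin 3 → List Bool} (j : ℕ) :
    tape s p l (p + (j + 1)) = some ((l 1)[j]?, (l 2)[j]?) := by
  have h1 : p + (j + 1 : ℤ) ≠ p := by omega
  have h2 : ¬ p + (j + 1 : ℤ) < p := by omega
  simp [tape, h1, h2]

theorem tape_left {s : TrackSymbol} {l : Fin 3 → List Bool} (j : ℕ) :
    tape s p l (p - (j + 1)) = some ((l 0)[j]?, none) := by
  have h1 : p - (j + 1 : ℤ) ≠ p := by omega
  have h2 : p - (j + 1 : ℤ) < p := by omega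
  simp [tape, h1, h2]

theorem getElem?_take_of_ne {α : Type*} {l : List α} {j k : ℕ} (h : k ≠ j) :
    (l.take j)[k]? = (l.take (j + 1))[k]? := by
  rw [List.getElem?_take, List.getElem?_take]
  split_ifs <;> first | rfl | omega

theorem update_tape_right {s : TrackSymbol} {a b c : List Bool} (j : ℕ) :
    Function.update (tape s p ![a, b.take (j + 1), c.take (j + 1)]) (p + (j + 1))
      (some (none, none)) = tape s p ![a, b.take j, c.take j] := by
  funext z
  rcases eq_or_ne z (p + (j + 1)) with rfl | hz
  · rw [Function.update_self, tape_right]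
    simp
  · rw [Function.update_of_ne hz]
    unfold tape
    split_ifs
    · rfl
    · simp
    · have : (z - p - 1).toNat ≠ j := by omega
      simp only [Matrix.cons_val, getElem?_take_of_ne this]

theorem update_tape_left {s : TrackSymbol} {a b c : List Bool} (x : Bool) :
    Function.update (tape s p ![a ++ [x], b, c]) (p - (a.length + 1))
      (some (none, none)) = tape s p ![a, b, c] := by
  funext z
  rcases eq_or_ne z (p - (a.length + 1)) with rfl | hz
  · rw [Function.update_self, tape_left]
    simp
  · rw [Function.update_of_ne hz]
    unfold tape
    split_ifs
    · rfl
    · have : (p - 1 - z).toNat ≠ a.length := by omega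
      simp only [Matrix.cons_val]
      rcases lt_or_gt_of_ne this with h | h
      · rw [List.getElem?_append_left h]
      · rw [List.getElem?_eq_none (by simpa using h), List.getElem?_eq_none h.le]
    · simp

theorem abs_add_le {L j : ℕ} (hB : |p| + L ≤ B) (hj : j ≤ L) : |p + j| ≤ B ∧ |p - j| ≤ B := by
  constructor <;> simp only [abs_le] at * <;> rcases abs_cases p with h | h <;> omega

/-- The walk from the input position to the centre. -/
theorem reaches_seek (l : Fin 3 → List Bool) (n : ℕ) (h : ℤ) (hh : 0 ≤ h) (hp : p = h + n)
    (hB : p ≤ B) :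
    Reaches (machine P).step (near P B) (conf P .seek h (tape none p l))
      (conf P (.run (cap _ 0)) p (tape none p l)) := by
  have hb : |h| ≤ B := by rw [abs_of_nonneg hh]; omega
  induction n generalizing h with
  | zero =>
    obtain rfl : p = h := by simpa using hp
    refine reaches_step (q' := .run (cap _ 0)) (a := none) (d := .stay) hb ?_ ?_
    · simp [transition]
    · rw [update_tape_center]
      simpa [HeadMove.offset] using reaches_self hb
  | succ n ih =>
    obtain ⟨c, hc⟩ : ∃ c, tape none p l h = some c := by
      unfold tape
      rw [if_neg (by omega)]
      split_ifs <;> simp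
    refine reaches_step (q' := .seek) (a := some c) (d := .right) hb ?_ ?_
    · rw [hc]; rfl
    · rw [update_tape_self _ hc]
      refine ih (h + 1) (by omega) (by push_cast at hp; omega) ?_
      rw [abs_of_nonneg (by omega)]; omega

/-- Both tracks are filled contiguously from the centre, so the first cell empty on both lies beyond
both lists. The number `n` bounds the cells still to be inspected. -/
theorem reaches_findRight {L : ℕ} (hB : |p| + (L + 1 : ℕ) ≤ B) (a b c : List Bool) (n j : ℕ)
    (hj : j + n ≤ L) (hb : b.length ≤ j + n) (hc : c.length ≤ j + n) :
    ∃ m ≤ L, b.length ≤ m ∧ c.length ≤ m ∧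
      Reaches (machine P).step (near P B)
        (conf P .findRight (p + (j + 1)) (tape none p ![a, b, c]))
        (conf P .eraseBack (p + m) (tape none p ![a, b, c])) := by
  induction n generalizing j with
  | zero =>
    refine ⟨j, hj, hb, hc, ?_⟩
    have hcell : tape none p ![a, b, c] (p + (j + 1)) = some (none, none) := by
      rw [tape_right]
      simpa using ⟨hb, hc⟩
    refine reaches_step (q' := .eraseBack) (a := some (none, none)) (d := .left) ?_ ?_ ?_
    · exact_mod_cast (abs_add_le hB (by omega : j + 1 ≤ L + 1)).1
    · rw [hcell]; simp [transition]
    · rw [update_tape_self _ hcell]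
      have e : p + (j + 1 : ℤ) + HeadMove.left.offset = p + j := by
        simp only [HeadMove.offset]; ring
      rw [e]
      exact reaches_self (abs_add_le hB (by omega)).1
  | succ n ih =>
    have hbd : |p + (j + 1 : ℤ)| ≤ B := by
      exact_mod_cast (abs_add_le hB (by omega : j + 1 ≤ L + 1)).1
    by_cases hcell : tape none p ![a, b, c] (p + (j + 1)) = some (none, none)
    · refine ⟨j, by omega, ?_, ?_, ?_⟩
      · rw [tape_right] at hcell
        simp at hcell
        exact hcell.1
      · rw [tape_right] at hcell
        simp at hcell
        exact hcell.2
      · refine reaches_step (q' := .eraseBack) (a := some (none, none)) (d := .left) hbd ?_ ?_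
        · rw [hcell]; simp [transition]
        · rw [update_tape_self _ hcell]
          have e : p + (j + 1 : ℤ) + HeadMove.left.offset = p + j := by
            simp only [HeadMove.offset]; ring
          rw [e]
          exact reaches_self (abs_add_le hB (by omega)).1
    · obtain ⟨m, hm, hbm, hcm, hr⟩ := ih (j + 1) (by omega) (by omega) (by omega)
      refine ⟨m, hm, hbm, hcm, ?_⟩
      refine reaches_step (q' := .findRight) (a := tape none p ![a, b, c] (p + (j + 1)))
        (d := .right) hbd ?_ ?_
      · rw [tape_right] at hcell ⊢
        simp only [Option.some.injEq] at hcell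
        simp only [transition, hcell, if_false]
      · rw [update_tape_self _ rfl]
        convert hr using 2
        simp only [HeadMove.offset]; push_cast; ring

/-- Truncation to `m` describes the partly erased right half; at `m = 0` the head is on the centre,
which is blanked as well. -/
theorem reaches_eraseBack {L : ℕ} (hB : |p| + (L + 1 : ℕ) ≤ B) (a b c : List Bool) (m : ℕ)
    (hm : m ≤ L) :
    Reaches (machine P).step (near P B)
      (conf P .eraseBack (p + m) (tape none p ![a, b.take m, c.take m]))
      (conf P .findLeft (p - 1) (tape (some (none, none)) p ![a, [], []])) := by
  induction m with
  | zero =>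
    refine reaches_step (q' := .findLeft) (a := some (none, none)) (d := .left)
      (abs_add_le hB (by omega)).1 ?_ ?_
    · simp [transition]
    · have h1 := (abs_add_le hB (by omega : 1 ≤ L + 1)).2
      simp [update_tape_center, HeadMove.offset, ← sub_eq_add_neg]
      exact reaches_self (by simpa using h1)
  | succ m ih =>
    refine reaches_step (q' := .eraseBack) (a := some (none, none)) (d := .left)
      (abs_add_le hB (by omega)).1 ?_ ?_
    · push_cast
      rw [tape_right]; rfl
    · push_cast
      rw [update_tape_right]
      convert ih (by omega) using 2
      simp only [HeadMove.offset]; ring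

theorem reaches_findLeft {L : ℕ} (hB : |p| + (L + 1 : ℕ) ≤ B) (s : TrackSymbol) (a : List Bool)
    (ha : a.length ≤ L) (n j : ℕ) (hn : j + n = a.length) :
    Reaches (machine P).step (near P B)
      (conf P .findLeft (p - (j + 1)) (tape s p ![a, [], []]))
      (conf P .eraseZeros (p - a.length) (tape s p ![a, [], []])) := by
  have hbd : |p - (j + 1 : ℤ)| ≤ B := by
    exact_mod_cast (abs_add_le hB (by omega : j + 1 ≤ L + 1)).2
  induction n generalizing j with
  | zero =>
    obtain rfl : j = a.length := by simpa using hn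
    have hcell : tape s p ![a, [], []] (p - (a.length + 1)) = some (none, none) := by
      rw [tape_left]; simp
    refine reaches_step (q' := .eraseZeros) (a := some (none, none)) (d := .right) hbd ?_ ?_
    · rw [hcell]; rfl
    · rw [update_tape_self _ hcell]
      have e : p - (a.length + 1 : ℤ) + HeadMove.right.offset = p - a.length := by
        simp [HeadMove.offset]; ring
      rw [e]
      exact reaches_self (abs_add_le hB (by omega)).2
  | succ n ih =>
    have hcell : tape s p ![a, [], []] (p - (j + 1)) = some (some a[j], none) := by
      rw [tape_left]; simp
    refine reaches_step (q' := .findLeft) (a := some (some a[j], none)) (d := .left) hbd ?_ ?_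
    · rw [hcell]; rfl
    · rw [update_tape_self _ hcell]
      convert ih (j + 1) (by omega) ?_ using 2
      · simp [HeadMove.offset]; ring
      · exact_mod_cast (abs_add_le hB (by omega : j + 1 + 1 ≤ L + 1)).2

/-- The base symbol of a bit. -/
abbrev bitSymbol (b : Bool) : BaseSymbol := if b then .one else .zero

theorem baseSymbol_getD (l : List Bool) (k : ℕ) :
    baseSymbol ((l.map bitSymbol).getD k .blank) = some (l[k]?, none) := by
  rw [List.getD_eq_getElem?_getD, List.getElem?_map]
  rcases l[k]? with _ | _ | _ <;> rfl

theorem getD_reverse_map (l : List Bool) {k : ℕ} (hk : k < l.length) :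
    (l.map bitSymbol).reverse.getD k .blank =
      (l.map bitSymbol).getD (l.length - 1 - k) .blank := by
  rw [List.getD_eq_getElem?_getD, List.getD_eq_getElem?_getD, List.getElem?_reverse (by simpa)]
  simp

theorem tapeOf_bin (a : List Bool) (h : a = (bitsValue a).bits) :
    tape (some (none, none)) p ![a, [], []] =
      (machine P).tapeOf (p - (a.length + 1)) (bin (bitsValue a)) := by
  funext z
  have hbin : bin (bitsValue a) = (a.map bitSymbol).reverse := by
    unfold bin
    rw [← h]
  rw [hbin]
  change _ = baseSymbol _
  unfold tape
  split_ifs with h1 h2 h3 h3 h4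
  · subst h1
    rw [List.getD_eq_default _ _ (by simp)]
    rfl
  · omega
  · rw [getD_reverse_map _ (by omega), baseSymbol_getD]
    simp only [Matrix.cons_val]
    congr 3
    omega
  · have : a.length ≤ (p - 1 - z).toNat := by omega
    simp only [Matrix.cons_val]
    rw [List.getElem?_eq_none this]
    rfl
  · rw [List.getD_eq_default _ _ (by simp; omega)]
    simp; rfl
  · omega

/-- Induction from the most significant end: leading zeros disappear until a one is met. For the
value zero there is none, and the machine stops on the erased centre of a blank tape. -/
theorem reaches_eraseZeros {L : ℕ} (hB : |p| + (L + 1 : ℕ) ≤ B) (a : List Bool)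
    (ha : a.length ≤ L) :
    ∃ d, Reaches (machine P).step (near P B)
      (conf P .eraseZeros (p - a.length) (tape (some (none, none)) p ![a, [], []])) d ∧
      (machine P).Halted d ∧ d.tape = (machine P).tapeOf d.head (bin (bitsValue a)) := by
  induction a using List.reverseRecOn with
  | nil =>
    refine ⟨_, reaches_self (abs_add_le hB (by omega)).2, ?_, ?_⟩
    · change transition P .eraseZeros _ = none
      simp [conf, transition]
    · change tape (some (none, none)) p ![[], [], []] = fun i => baseSymbol _
      funext z
      have h1 : tape (some (none, none)) p ![[], [], []] z = some (none, none) := by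
        unfold tape; split_ifs <;> simp
      rw [h1]
      simp [bin]
      rfl
  | append_singleton a x ih =>
    have hcell : tape (some (none, none)) p ![a ++ [x], [], []] (p - (a.length + 1)) =
        some (some x, none) := by
      rw [tape_left]; simp
    simp only [List.length_append, List.length_singleton] at ha ⊢
    have hbd : |p - ((a.length + 1 : ℕ) : ℤ)| ≤ B := (abs_add_le hB (by omega)).2
    cases x with
    | false =>
      obtain ⟨d, hr, hd, ht⟩ := ih (by omega)
      refine ⟨d, ?_, hd, ?_⟩
      · refine reaches_step (q' := .eraseZeros) (a := some (none, none)) (d := .right) hbd ?_ ?_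
        · push_cast
          rw [hcell]; rfl
        · push_cast
          rw [update_tape_left]
          convert hr using 2
          simp [HeadMove.offset]; ring
      · rw [ht, bitsValue_append]; simp
    | true =>
      have hbits := (bits_bitsValue (a ++ [true]) (by simp)).1
      refine ⟨conf P .done (p - ((a.length + 1 : ℕ) + 1))
        (tape (some (none, none)) p ![a ++ [true], [], []]), ?_, rfl, ?_⟩
      · refine reaches_step (q' := .done) (a := some (some true, none)) (d := .left) hbd ?_ ?_
        · push_cast
          rw [hcell]; rfl
        · push_cast
          rw [update_tape_self _ hcell]
          have e : p - (a.length + 1 : ℤ) + HeadMove.left.offset = p - (a.length + 1 + 1) := by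
            simp [HeadMove.offset]; ring
          rw [e]
          refine reaches_self ?_
          exact_mod_cast (abs_add_le hB (by omega : a.length + 1 + 1 ≤ L + 1)).2
      · have := tapeOf_bin (P := P) (p := p) (a ++ [true]) hbits.symm
        rw [List.length_append, List.length_singleton] at this
        exact this

/-- No preprocessing is needed: because `bin y` is reversed, both numbers already have their least
significant bits next to the separator, and the third counter is the empty list. -/
theorem init_tape (x y : ℕ) :
    (machine P).init (pairInput x y) =
      conf P .seek 0 (tape none (x.bits.length + 1) ![x.bits, y.bits, []]) := by
  change conf P .seek 0 (fun i => baseSymbol _) = _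
  congr 1
  funext z
  have hx : bin x = (x.bits.map bitSymbol).reverse := rfl
  have hy : (bin y).reverse = y.bits.map bitSymbol := by
    unfold bin; rw [List.reverse_reverse]
  have hlen : (bin x).length = x.bits.length := by simp [bin]
  unfold pairInput tape
  rw [hy]
  split_ifs with h1 h2 h3 h2 h3
  · subst h2
    rw [List.getD_append_right _ _ _ _ (by omega)]
    simp [hlen]
    rfl
  · rw [List.getD_append _ _ _ _ (by omega), hx, getD_reverse_map _ (by omega), baseSymbol_getD]
    simp only [Matrix.cons_val]
    congr 3
    omega
  · rw [List.getD_append_right _ _ _ _ (by omega)]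
    have e : (z - 0 - 1).toNat - (bin x).length = (z - (x.bits.length + 1) - 1).toNat + 1 := by omega
    rw [e, List.getD_cons_succ, baseSymbol_getD]
    simp
  · omega
  · have : x.bits.length ≤ ((x.bits.length : ℤ) + 1 - 1 - z).toNat := by omega
    simp only [Matrix.cons_val]
    rw [List.getElem?_eq_none this]
    rfl
  · omega

theorem length_pairInput (x y : ℕ) :
    (pairInput x y).length = x.bits.length + y.bits.length + 1 := by
  simp [pairInput, bin]; omega

/-- The complete simulation, for counter values below `2 ^ L`. -/
theorem exists_halted {x y L t : ℕ} (hx : x.bits.length ≤ L) (hy : y.bits.length ≤ L)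
    (hval : ∀ s ≤ t, ∀ i, (P.step^[s] ⟨0, ![x, y, 0]⟩).val i < 2 ^ L)
    (ht : P.Halted (P.step^[t] ⟨0, ![x, y, 0]⟩)) :
    ∃ d, Reaches (machine P).step (near P (2 * L + 2)) ((machine P).init (pairInput x y)) d ∧
      (machine P).Halted d ∧ d.tape =
        (machine P).tapeOf d.head (bin ((P.step^[t] ⟨0, ![x, y, 0]⟩).val 0)) := by
  -- The centre is at most `L + 1` cells from the start, and the walks go at most `L + 1` cells
  -- beyond it.
  set B := 2 * L + 2 with hBdef
  set p : ℤ := x.bits.length + 1 with hp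
  have hB : |p| + (L + 1 : ℕ) ≤ B := by
    rw [abs_of_nonneg (by omega)]; push_cast; omega
  rw [init_tape, ← hp]
  have h₁ := reaches_seek (P := P) (p := p) (B := B) ![x.bits, y.bits, []] (x.bits.length + 1) 0
    le_rfl (by simp [hp]) (by omega)
  obtain ⟨d₂, hrep, h₂⟩ := Reaches.simulate (f := (machine P).step) (S := near P B) (g := P.step)
    (T := {c | ∀ i, c.val i < 2 ^ L}) (R := Represents p L)
    (fun c _ hc d hd => represents_step hB hc hd)
    (fun c _ d hd => by
      obtain ⟨l, -, rfl⟩ := hd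
      change |p| ≤ B
      omega)
    (x := ⟨0, ![x, y, 0]⟩) ⟨t, rfl, hval⟩
    (y := conf P (.run (cap _ 0)) p (tape none p ![x.bits, y.bits, []]))
    ⟨![x.bits, y.bits, []], by
      intro i; fin_cases i <;> simp [bitsValue_bits, hx, hy], rfl⟩
  obtain ⟨l, hl, rfl⟩ := hrep
  obtain ⟨a, b, c, rfl⟩ : ∃ a b c, l = ![a, b, c] :=
    ⟨l 0, l 1, l 2, by funext i; fin_cases i <;> rfl⟩
  have ha : bitsValue a = _ ∧ a.length ≤ L := hl 0
  have hb : bitsValue b = _ ∧ b.length ≤ L := hl 1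
  have hc : bitsValue c = _ ∧ c.length ≤ L := hl 2
  obtain ⟨m, hm, hbm, hcm, h₃⟩ := reaches_findRight (P := P) hB a b c L 0 (by omega)
    (by omega) (by omega)
  have h₄ := reaches_eraseBack (P := P) hB a b c m hm
  rw [List.take_of_length_le hbm, List.take_of_length_le hcm] at h₄
  have h₅ := reaches_findLeft (P := P) hB (some (none, none)) a ha.2 a.length 0 (by omega)
  obtain ⟨d, h₆, hd, htape⟩ := reaches_eraseZeros (P := P) hB a ha.2
  rw [← ha.1]
  refine ⟨d, h₁.trans (h₂.trans ?_), hd, htape⟩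
  refine reaches_step (q' := .findRight) (a := none) (d := .right) (by omega) ?_ ?_
  · unfold CounterProgram.Halted at ht
    simp [transition, getElem?_cap, ht]
  · rw [update_tape_center]
    simp only [Nat.cast_zero, zero_add] at h₃ h₅
    exact h₃.trans (h₄.trans (h₅.trans h₆))

end CounterToTuring

/-! ### Counter growth and the linear space bound -/

theorem CounterProgram.step_val_le (P : CounterProgram 3) (c : CounterConfig 3) {n : ℕ}
    (h : ∀ i, c.val i ≤ n) (i : Fin 3) : (P.step c).val i ≤ n + 1 := by
  have hi := h i
  unfold CounterProgram.step
  split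
  · rename_i j _
    rcases eq_or_ne i j with rfl | hij
    · simpa using hi
    · simp [hij]; omega
  · rename_i j _ _
    split_ifs
    · rcases eq_or_ne i j with rfl | hij
      · simp; omega
      · simp [hij]; omega
    · simp; omega
  all_goals (simp; omega)

theorem CounterProgram.iterate_val_le (P : CounterProgram 3) (c : CounterConfig 3) {n : ℕ}
    (h : ∀ i, c.val i ≤ n) (s : ℕ) (i : Fin 3) : (P.step^[s] c).val i ≤ n + s := by
  induction s generalizing i with
  | zero => exact h i
  | succ s ih =>
    rw [Function.iterate_succ_apply']
    exact P.step_val_le _ ih i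

/-- Induction on the polynomial: a sum or a further factor `X` only increases the constant. The
summand `1` in the exponent is needed for `m = 0`, where the bit list is empty. -/
theorem exists_eval_lt_two_pow (q : Polynomial ℕ) :
    ∃ C, ∀ m : ℕ, q.eval m < 2 ^ (C * (m.bits.length + 1)) := by
  have hm (m : ℕ) : m < 2 ^ (1 * (m.bits.length + 1)) := by
    have : m < 2 ^ m.bits.length := by
      rw [Nat.size_eq_bits_len]; exact Nat.lt_size_self m
    rw [one_mul, pow_succ]; omega
  induction q using Polynomial.induction_on with
  | C a =>
    refine ⟨a, fun m => ?_⟩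
    rw [Polynomial.eval_C]
    exact Nat.lt_two_pow_self.trans_le
      (Nat.pow_le_pow_right (by omega) (Nat.le_mul_of_pos_right _ (by omega)))
  | add p q hp hq =>
    obtain ⟨C, hC⟩ := hp
    obtain ⟨D, hD⟩ := hq
    refine ⟨C + D + 1, fun m => ?_⟩
    have h1 := hC m
    have h2 := hD m
    have e1 : 2 ^ (C * (m.bits.length + 1)) ≤ 2 ^ ((C + D) * (m.bits.length + 1)) :=
      Nat.pow_le_pow_right (by omega) (Nat.mul_le_mul_right _ (by omega))
    have e2 : 2 ^ (D * (m.bits.length + 1)) ≤ 2 ^ ((C + D) * (m.bits.length + 1)) :=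
      Nat.pow_le_pow_right (by omega) (Nat.mul_le_mul_right _ (by omega))
    have e3 : 2 * 2 ^ ((C + D) * (m.bits.length + 1)) ≤
        2 ^ ((C + D + 1) * (m.bits.length + 1)) := by
      rw [← pow_succ']
      exact Nat.pow_le_pow_right (by omega) (by nlinarith)
    rw [Polynomial.eval_add]
    omega
  | monomial n a h =>
    obtain ⟨C, hC⟩ := h
    refine ⟨C + 1, fun m => ?_⟩
    rw [pow_succ, ← mul_assoc, Polynomial.eval_mul, Polynomial.eval_X, add_mul, pow_add]
    exact Nat.mul_lt_mul'' (hC m) (hm m)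

theorem TuringLinearSpace.of_threeCounterPolyTime {f : ℕ → ℕ → ℕ} (hf : ThreeCounterPolyTime f) :
    TuringLinearSpace f := by
  obtain ⟨P, p, hP⟩ := hf
  -- A counter starts at most at `m` and gains at most one per step, so `X + p` bounds all values.
  obtain ⟨C, hC⟩ := exists_eval_lt_two_pow (Polynomial.X + p)
  -- The head stays within `2 * L + 2` for `L = (C + 1) * n`; since the input word is nonempty, the
  -- summand `2` is at most `2 * n`.
  refine ⟨CounterToTuring.machine P, 2 * (C + 1) + 2, fun x y => ?_⟩
  obtain ⟨t, ht, hhalt, hval⟩ := hP x y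
  set m := max x y with hm
  set n := (pairInput x y).length with hn
  have hlen := CounterToTuring.length_pairInput x y
  have hmn : m.bits.length + 1 ≤ n := by
    rcases max_choice x y with h | h <;> rw [hm, h, hn, hlen] <;> omega
  have hL (s : ℕ) (hs : s ≤ t) (i : Fin 3) :
      (P.step^[s] ⟨0, ![x, y, 0]⟩).val i < 2 ^ ((C + 1) * n) := by
    have h1 := P.iterate_val_le ⟨0, ![x, y, 0]⟩ (n := m)
      (by intro i; fin_cases i <;> simp [hm]) s i
    have h2 := hC m
    rw [Polynomial.eval_add, Polynomial.eval_X] at h2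
    have h3 : 2 ^ (C * (m.bits.length + 1)) ≤ 2 ^ ((C + 1) * n) :=
      Nat.pow_le_pow_right (by omega) (Nat.mul_le_mul (by omega) hmn)
    omega
  have hLn : n ≤ (C + 1) * n := Nat.le_mul_of_pos_left _ (by omega)
  obtain ⟨d, ⟨T, hT, hS⟩, hd, htape⟩ := CounterToTuring.exists_halted (by omega) (by omega) hL hhalt
  have hfix : (CounterToTuring.machine P).step d = d := by
    unfold TuringMachine.Halted at hd
    simp [TuringMachine.step, hd]
  refine ⟨⟨T, by rwa [hT], by rw [hT, htape, hval]⟩, fun s => ?_⟩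
  have := Reaches.forall_iterate_mem ⟨T, hT, hS⟩ hfix s
  refine le_trans this ?_
  have : 2 * ((C + 1) * n) + 2 ≤ (2 * (C + 1) + 2) * n := by
    have : 1 ≤ n := by omega
    nlinarith
  exact_mod_cast this

/-! ### Counter machines with an arbitrary finite set of control states -/

inductive GraphInstr (Q : Type) : Type
  | inc (i : Fin 3) (q : Q)
  | dec (i : Fin 3) (q z : Q)
  | goto (q : Q)
  | halt

namespace GraphInstr

variable {Q : Type}

/-- One step of the machine with instructions `G`; in an instruction `dec i q z` the control passes
to `z` if counter `i` is zero. -/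
def step (G : Q → GraphInstr Q) (c : Q × (Fin 3 → ℕ)) : Q × (Fin 3 → ℕ) :=
  match G c.1 with
  | .inc i q => (q, Function.update c.2 i (c.2 i + 1))
  | .dec i q z => if 0 < c.2 i then (q, Function.update c.2 i (c.2 i - 1)) else (z, c.2)
  | .goto q => (q, c.2)
  | .halt => c

/-- The configurations with counter values at most `V`. -/
def bounded (Q : Type) (V : ℕ) : Set (Q × (Fin 3 → ℕ)) := {c | ∀ i, c.2 i ≤ V}

variable {n : ℕ}

def addr (e : Q ≃ Fin n) (q : Q) : ℕ := 2 * (e q : ℕ) + 1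

/-- The two program lines of a control state. -/
def lines (e : Q ≃ Fin n) : GraphInstr Q → CounterInstr 3 × CounterInstr 3
  | .inc i q => (.inc i, .jump (addr e q))
  | .dec i q z => (.dec i (addr e z), .jump (addr e q))
  | .goto q => (.jump (addr e q), .halt)
  | .halt => (.halt, .halt)

/-- State number `j` owns the lines `2 * j + 1` and `2 * j + 2`; the second holds the jump that
replaces falling through. Line `0` is reserved for the jump to the start state. -/
def compile (e : Q ≃ Fin n) (G : Q → GraphInstr Q) (start : Q) : CounterProgram 3 :=
  .jump (addr e start) :: List.ofFn fun j : Fin (2 * n) =>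
    if j.val % 2 = 0 then (lines e (G (e.symm ⟨j / 2, by omega⟩))).1
    else (lines e (G (e.symm ⟨j / 2, by omega⟩))).2

variable {e : Q ≃ Fin n} {G : Q → GraphInstr Q} {start : Q}

theorem compile_addr (q : Q) : (compile e G start)[addr e q]? = some (lines e (G q)).1 := by
  simp [compile, addr]

theorem compile_addr_succ (q : Q) :
    (compile e G start)[addr e q + 1]? = some (lines e (G q)).2 := by
  have h : 2 * (e q : ℕ) + 1 < 2 * n := by omega
  have h1 : (2 * (e q : ℕ) + 1) / 2 = e q := by omega
  have h2 : (2 * (e q : ℕ) + 1) % 2 = 1 := by omega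
  simp [compile, addr, h, h1, h2]

open Classical in
/-- The configurations of a compiled program with counter values at most `V`. -/
noncomputable def progBounded (n V : ℕ) : Finset (CounterConfig 3) :=
  (Finset.range (2 * n + 1) ×ˢ Fintype.piFinset fun _ : Fin 3 => Finset.range (V + 1)).image
    fun c => ⟨c.1, c.2⟩

theorem mem_progBounded {V : ℕ} {c : CounterConfig 3} :
    c ∈ progBounded n V ↔ c.pc < 2 * n + 1 ∧ ∀ i, c.val i ≤ V := by
  obtain ⟨pc, v⟩ := c
  simp [progBounded]

theorem card_progBounded_le (n V : ℕ) : (progBounded n V).card ≤ (2 * n + 1) * (V + 1) ^ 3 := by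
  classical
  refine Finset.card_image_le.trans ?_
  simp

theorem compile_step {V : ℕ} {c : Q × (Fin 3 → ℕ)} (hc : ∀ i, c.2 i ≤ V)
    (hc' : ∀ i, (step G c).2 i ≤ V) :
    Reaches (compile e G start).step (progBounded n V : Set (CounterConfig 3))
      ⟨addr e c.1, c.2⟩ ⟨addr e (step G c).1, (step G c).2⟩ := by
  obtain ⟨q, v⟩ := c
  have hlt (q : Q) : addr e q + 1 < 2 * n + 1 := by unfold addr; omega
  have h1 := compile_addr (e := e) (G := G) (start := start) q
  have h2 := compile_addr_succ (e := e) (G := G) (start := start) q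
  have hs : ∀ (q : Q) (v : Fin 3 → ℕ), (∀ i, v i ≤ V) →
      (⟨addr e q, v⟩ : CounterConfig 3) ∈ (progBounded n V : Set _) := fun q v hv => by
    rw [Finset.mem_coe, mem_progBounded]
    exact ⟨(Nat.lt_succ_self _).trans (hlt q), hv⟩
  have hs' : ∀ (q : Q) (v : Fin 3 → ℕ), (∀ i, v i ≤ V) →
      (⟨addr e q + 1, v⟩ : CounterConfig 3) ∈ (progBounded n V : Set _) := fun q v hv => by
    rw [Finset.mem_coe, mem_progBounded]
    exact ⟨hlt q, hv⟩
  -- One program step executes the first line of the state; only an increment or a successful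
  -- decrement needs a second step, the jump.
  refine Reaches.head (hs _ _ hc) ?_
  rcases hG : G q with ⟨i, q'⟩ | ⟨i, q', z⟩ | q' | _
  · simp only [step, hG] at hc' ⊢
    simp only [hG, lines] at h1 h2
    refine Reaches.head_eq (c := ⟨addr e q', Function.update v i (v i + 1)⟩) ?_ ?_
      (Reaches.refl (hs _ _ hc')) <;> simp only [CounterProgram.step, h1]
    · exact hs' _ _ hc'
    · simp only [h2]
  · simp only [hG, lines] at h1 h2
    by_cases hv : 0 < v i
    · simp only [step, hG, hv, if_true] at hc' ⊢
      refine Reaches.head_eq (c := ⟨addr e q', Function.update v i (v i - 1)⟩) ?_ ?_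
        (Reaches.refl (hs _ _ hc')) <;> simp only [CounterProgram.step, h1, hv, if_true]
      · exact hs' _ _ hc'
      · simp only [h2]
    · simp only [step, hG, hv, if_false, CounterProgram.step, h1]
      exact Reaches.refl (hs _ _ hc)
  · simp only [hG, lines] at h1
    simp only [step, hG, CounterProgram.step, h1]
    exact Reaches.refl (hs _ _ hc)
  · simp only [hG, lines] at h1
    simp only [step, hG, CounterProgram.step, h1]
    exact Reaches.refl (hs _ _ hc)

/-- A halting run with bounded counters yields a halting run of the compiled program whose length
is bounded by the number of configurations. -/
theorem compile_halts {V : ℕ} {v w : Fin 3 → ℕ} {q : Q} (hq : G q = .halt)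
    (h : Reaches (step G) (bounded Q V) (start, v) (q, w)) :
    ∃ t ≤ (2 * n + 1) * (V + 1) ^ 3,
      (compile e G start).Halted ((compile e G start).step^[t] ⟨0, v⟩) ∧
      ((compile e G start).step^[t] ⟨0, v⟩).val = w := by
  have hv := h.left_mem
  obtain ⟨_, rfl, hr⟩ := Reaches.simulate (f := (compile e G start).step)
    (S := (progBounded n V : Set (CounterConfig 3)))
    (R := fun c d => d = ⟨addr e c.1, c.2⟩)
    (fun c hc hc' d hd => ⟨_, rfl, hd ▸ compile_step hc hc'⟩)
    (fun c hc d hd => hd ▸ by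
      rw [Finset.mem_coe, mem_progBounded]
      refine ⟨?_, hc⟩
      simp only [addr]; omega) h rfl
  have h0 : Reaches (compile e G start).step (progBounded n V : Set (CounterConfig 3)) ⟨0, v⟩
      ⟨addr e q, w⟩ := by
    refine Reaches.head_eq ?_ ?_ hr
    · rw [Finset.mem_coe, mem_progBounded]
      exact ⟨by simp, hv⟩
    · simp [CounterProgram.step, compile]
  -- The time bound comes from counting configurations; the length of the simulation itself is never
  -- estimated.
  obtain ⟨t, ht, e'⟩ := h0.exists_le_card
  refine ⟨t, ht.trans (card_progBounded_le n V), ?_, ?_⟩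
  · rw [e']
    simp [CounterProgram.Halted, compile_addr, hq, lines]
  · rw [e']

variable {V : ℕ} {q q' z : Q} {u : Fin 3 → ℕ} {i : Fin 3} {b : Q × (Fin 3 → ℕ)}

theorem reaches_inc (hq : G q = .inc i q') (hu : ∀ j, u j ≤ V)
    (h : Reaches (step G) (bounded Q V) (q', Function.update u i (u i + 1)) b) :
    Reaches (step G) (bounded Q V) (q, u) b :=
  Reaches.head_eq hu (by simp [step, hq]) h

theorem reaches_dec (hq : G q = .dec i q' z) (hu : ∀ j, u j ≤ V) (hi : 0 < u i)
    (h : Reaches (step G) (bounded Q V) (q', Function.update u i (u i - 1)) b) :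
    Reaches (step G) (bounded Q V) (q, u) b :=
  Reaches.head_eq hu (by simp [step, hq, hi]) h

theorem reaches_dec_zero (hq : G q = .dec i q' z) (hu : ∀ j, u j ≤ V) (hi : u i = 0)
    (h : Reaches (step G) (bounded Q V) (z, u) b) :
    Reaches (step G) (bounded Q V) (q, u) b :=
  Reaches.head_eq hu (by simp [step, hq, hi]) h

theorem reaches_goto (hq : G q = .goto q') (hu : ∀ j, u j ≤ V)
    (h : Reaches (step G) (bounded Q V) (q', u) b) :
    Reaches (step G) (bounded Q V) (q, u) b :=
  Reaches.head_eq hu (by simp [step, hq]) h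

end GraphInstr

/-! ### Stack operations on counters -/

/-- Operations on a counter `i` that is viewed as a stack of base `k` digits. -/
inductive StackInstr (Q : Type) : Type
  /-- replace the value `a` of counter `i` by `k * a + d` -/
  | push (i : Fin 3) (k d : ℕ) (q : Q)
  /-- replace the value `a` of counter `i` by `a / k` and branch on `a % k` -/
  | pop (i : Fin 3) (k : ℕ) (next : ℕ → Q)
  /-- test counter `i` for zero -/
  | test (i : Fin 3) (z q : Q)
  | halt

namespace StackInstr

/-- The number in `Fin (K + 1)` accompanying a phase is a register in the finite control: it counts
down additions during a push and holds the remainder during a pop. -/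
inductive Phase : Type
  | start
  | fill
  | add
  | copy
  | restore
  deriving DecidableEq

instance : Fintype Phase :=
  ⟨{.start, .fill, .add, .copy, .restore}, fun x => by cases x <;> simp⟩

open GraphInstr

variable {Q : Type} {K : ℕ}

/-- The implementation of the stack operations, with counter `2` as auxiliary storage. -/
def expand (K : ℕ) (M : Q → StackInstr Q) (c : Q × Phase × Fin (K + 1)) :
    GraphInstr (Q × Phase × Fin (K + 1)) :=
  match M c.1, c.2.1 with
  | .push i k d _, .start => .dec i (c.1, .fill, cap K k) (c.1, .add, cap K d)
  | .push _ _ _ _, .fill =>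
    if c.2.2 = 0 then .goto (c.1, .start, 0) else .inc 2 (c.1, .fill, cap K (c.2.2 - 1))
  | .push _ _ _ _, .add =>
    if c.2.2 = 0 then .goto (c.1, .copy, 0) else .inc 2 (c.1, .add, cap K (c.2.2 - 1))
  | .push _ _ _ q, .copy => .dec 2 (c.1, .restore, c.2.2) (q, .start, 0)
  | .push i _ _ _, .restore => .inc i (c.1, .copy, c.2.2)
  | .pop i k _, .start =>
    .dec i (if c.2.2 + 1 = k then (c.1, .fill, 0) else (c.1, .start, cap K (c.2.2 + 1)))
      (c.1, .copy, c.2.2)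
  | .pop _ _ _, .fill => .inc 2 (c.1, .start, 0)
  | .pop _ _ next, .copy => .dec 2 (c.1, .restore, c.2.2) (next c.2.2, .start, 0)
  | .pop i _ _, .restore => .inc i (c.1, .copy, c.2.2)
  | .test i z _, .start => .dec i (c.1, .restore, 0) (z, .start, 0)
  | .test i _ q, .restore => .inc i (q, .start, 0)
  | _, _ => .halt

/-- Counter contents `v`, with `a` in counter `i` and `c` in counter `2`. -/
def upd (v : Fin 3 → ℕ) (i : Fin 3) (a c : ℕ) : Fin 3 → ℕ :=
  Function.update (Function.update v i a) 2 c

variable {v : Fin 3 → ℕ} {i : Fin 3} {a c V : ℕ}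

theorem upd_fst (hi : i ≠ 2) : upd v i a c i = a := by simp [upd, hi]

theorem upd_snd : upd v i a c 2 = c := by simp [upd]

theorem update_upd_fst (hi : i ≠ 2) (a' : ℕ) :
    Function.update (upd v i a c) i a' = upd v i a' c := by
  funext j
  by_cases h2 : j = 2
  · subst h2; simp [upd, Function.update_of_ne hi.symm]
  · by_cases hj : j = i
    · subst hj; simp [upd, h2]
    · simp [upd, h2, hj]

theorem update_upd_snd (c' : ℕ) : Function.update (upd v i a c) 2 c' = upd v i a c' := by
  simp [upd]

theorem upd_self (h : v 2 = 0) : upd v i (v i) 0 = v := by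
  simp [upd, ← h]

theorem upd_zero (h : v 2 = 0) (hi : i ≠ 2) : upd v i a 0 = Function.update v i a := by
  rw [upd, ← h]
  conv_lhs => rw [← Function.update_of_ne hi.symm a v]
  rw [Function.update_eq_self]

theorem upd_le (hv : ∀ j, v j ≤ V) (ha : a ≤ V) (hc : c ≤ V) (j : Fin 3) : upd v i a c j ≤ V := by
  unfold upd
  by_cases h2 : j = 2
  · subst h2; simpa
  · by_cases hj : j = i
    · subst hj; simpa [h2]
    · simpa [h2, hj] using hv j

section Copy

variable {Q' : Type} {G : Q' → GraphInstr Q'} {q r ex : Q'}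

/-- The sum of the two counters is the same after each round, so `a + c ≤ V` controls the whole
loop. -/
theorem reaches_copy (hi : i ≠ 2) (hq : G q = .dec 2 r ex) (hr : G r = .inc i q)
    (hv : ∀ j, v j ≤ V) (hac : a + c ≤ V) :
    Reaches (step G) (bounded Q' V) (q, upd v i a c) (ex, upd v i (a + c) 0) := by
  induction c generalizing a with
  | zero =>
    have h := upd_le (i := i) hv (by omega : a ≤ V) (Nat.zero_le V)
    exact reaches_dec_zero hq h upd_snd (Reaches.refl h)
  | succ c ih =>
    refine reaches_dec hq (upd_le hv (by omega) (by omega)) (by simp [upd_snd]) ?_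
    rw [update_upd_snd, upd_snd, Nat.add_sub_cancel]
    refine reaches_inc hr (upd_le hv (by omega) (by omega)) ?_
    rw [update_upd_fst hi, upd_fst hi]
    convert ih (a := a + 1) (by omega) using 3
    omega

theorem reaches_incs {K : ℕ} (s : Fin (K + 1) → Q')
    (h0 : G (s 0) = .goto ex) (hs : ∀ j, j ≠ 0 → G (s j) = .inc 2 (s (cap K (j - 1))))
    (hv : ∀ j, v j ≤ V) (ha : a ≤ V) {j : ℕ} (hj : j ≤ K) (hc : c + j ≤ V) :
    Reaches (step G) (bounded Q' V) (s (cap K j), upd v i a c) (ex, upd v i a (c + j)) := by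
  induction j generalizing c with
  | zero =>
    have h := upd_le (i := i) hv ha hc
    exact reaches_goto h0 h (Reaches.refl h)
  | succ j ih =>
    refine reaches_inc (hs _ ?_) (upd_le hv ha (by omega)) ?_
    · rw [Ne, Fin.ext_iff, cap_val hj]; simp
    · rw [update_upd_snd, upd_snd, cap_val hj, Nat.add_sub_cancel]
      convert ih (c := c + 1) (by omega) (by omega) using 3
      omega

end Copy

variable {M : Q → StackInstr Q} {q : Q}

/-- Each unit taken from counter `i` adds `k` to counter `2`; then `d` is added and the result is
copied back. The invariant `k * a + c` of the first loop keeps counter `2` within the bound. -/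
theorem reaches_push {k d : ℕ} {q' : Q} (hM : M q = .push i k d q') (hi : i ≠ 2) (hk : k ≤ K)
    (hd : d ≤ K) (h2 : v 2 = 0) (hv : ∀ j, v j ≤ V) (hV : k * v i + d ≤ V) :
    Reaches (step (expand K M)) (bounded _ V) ((q, .start, 0), v)
      ((q', .start, 0), Function.update v i (k * v i + d)) := by
  have mul (a c : ℕ) (ha : a ≤ V) (hc : c + k * a ≤ V) :
      Reaches (step (expand K M)) (bounded _ V) ((q, .start, 0), upd v i a c)
        ((q, .add, cap K d), upd v i 0 (c + k * a)) := by
    induction a generalizing c with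
    | zero =>
      have h := upd_le (i := i) hv ha hc
      exact reaches_dec_zero (by simp [expand, hM]; rfl) h (upd_fst hi) (Reaches.refl h)
    | succ a ih =>
      rw [mul_add, mul_one] at hc
      refine reaches_dec (q' := (q, .fill, cap K k)) (z := (q, .add, cap K d)) (i := i)
        (by simp [expand, hM]) (upd_le hv ha (by omega)) (by simp [upd_fst hi]) ?_
      rw [update_upd_fst hi, upd_fst hi, Nat.add_sub_cancel]
      refine (reaches_incs (G := expand K M) (ex := (q, .start, 0)) (fun j => (q, .fill, j)) (by simp [expand, hM])
        (fun j hj => by simp [expand, hM, hj]) hv (by omega) hk (by omega)).trans ?_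
      convert ih (c + k) (by omega) (by omega) using 3
      ring
  have h1 := mul (v i) 0 (hv i) (by omega)
  rw [upd_self h2, Nat.zero_add] at h1
  have hadd := reaches_incs (G := expand K M) (i := i) (a := 0) (c := k * v i) (v := v)
    (ex := (q, .copy, 0))
    (fun j => (q, .add, j)) (by simp [expand, hM]) (fun j hj => by simp [expand, hM, hj]) hv
    (Nat.zero_le V) hd hV
  have hcopy := reaches_copy (G := expand K M) (q := (q, .copy, 0)) (r := (q, .restore, 0))
    (ex := (q', .start, 0)) (a := 0) (c := k * v i + d) hi
    (by simp [expand, hM]) (by simp [expand, hM]) hv (by omega)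
  rw [upd_zero h2 hi, Nat.zero_add] at hcopy
  exact h1.trans (hadd.trans hcopy)

/-- Division by counting: the remainder `r` lives in the finite control and every `k`-th decrement
adds one to counter `2`, so that `k * c + r + a` is invariant. -/
theorem reaches_pop {k : ℕ} {next : ℕ → Q} (hM : M q = .pop i k next) (hi : i ≠ 2) (hk : k ≤ K)
    (hk0 : 0 < k) (h2 : v 2 = 0) (hv : ∀ j, v j ≤ V) :
    Reaches (step (expand K M)) (bounded _ V) ((q, .start, 0), v)
      ((next (v i % k), .start, 0), Function.update v i (v i / k)) := by
  have div (a c r : ℕ) (hr : r < k) (ha : c + a ≤ V) :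
      Reaches (step (expand K M)) (bounded _ V) ((q, .start, cap K r), upd v i a c)
        ((q, .copy, cap K ((r + a) % k)), upd v i 0 (c + (r + a) / k)) := by
    induction a generalizing c r with
    | zero =>
      have h := upd_le (i := i) hv (Nat.zero_le V) ha
      rw [Nat.add_zero r, Nat.mod_eq_of_lt hr, Nat.div_eq_of_lt hr]
      exact reaches_dec_zero (by simp [expand, hM]; rfl) h (upd_fst hi) (Reaches.refl h)
    | succ a ih =>
      refine reaches_dec (i := i) (by simp only [expand, hM]; rfl) (upd_le hv (by omega) (by omega))
        (by simp [upd_fst hi]) ?_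
      rw [update_upd_fst hi, upd_fst hi, Nat.add_sub_cancel, cap_val (by omega)]
      split_ifs with hrk
      · refine reaches_inc (i := 2) (q' := (q, .start, cap K 0)) (by simp [expand, hM]; rfl)
          (upd_le hv (by omega) (by omega)) ?_
        rw [update_upd_snd, upd_snd]
        have e : r + (a + 1) = 0 + a + k := by omega
        rw [e, Nat.add_mod_right, Nat.add_div_right _ hk0]
        convert ih (c + 1) 0 hk0 (by omega) using 3
        omega
      · have e : r + (a + 1) = r + 1 + a := by omega
        rw [e]
        exact ih c (r + 1) (by omega) (by omega)
  have h1 := div (v i) 0 0 hk0 (by simpa using hv i)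
  rw [upd_self h2, Nat.zero_add, Nat.zero_add] at h1
  have hmod : v i % k < k := Nat.mod_lt _ hk0
  have hcopy := reaches_copy (G := expand K M) (q := (q, .copy, cap K (v i % k)))
    (r := (q, .restore, cap K (v i % k)))
    (ex := (next (v i % k), .start, 0)) (a := 0) (c := v i / k) (v := v) hi
    (by simp only [expand, hM, cap_val (hmod.le.trans hk)]) (by simp [expand, hM]) hv
    (by simpa using (Nat.div_le_self _ _).trans (hv i))
  rw [upd_zero h2 hi, Nat.zero_add] at hcopy
  exact h1.trans hcopy

/-- The only test available is a conditional decrement, which is undone when it succeeds. -/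
theorem reaches_test {z q' : Q} (hM : M q = .test i z q') (hv : ∀ j, v j ≤ V) :
    Reaches (step (expand K M)) (bounded _ V) ((q, .start, 0), v)
      ((if v i = 0 then z else q', .start, 0), v) := by
  split_ifs with h
  · exact reaches_dec_zero (by simp [expand, hM]; rfl) hv h (Reaches.refl hv)
  · refine reaches_dec (i := i) (by simp only [expand, hM]; rfl) hv (by omega) ?_
    refine reaches_inc (i := i) (q' := (q', .start, 0)) (by simp [expand, hM]) ?_ ?_
    · intro j
      by_cases hj : j = i
      · subst hj; simpa using (Nat.sub_le _ _).trans (hv j)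
      · simpa [hj] using hv j
    · have : v i - 1 + 1 = v i := by omega
      simp only [Function.update_self, Function.update_idem, this, Function.update_eq_self]
      exact Reaches.refl hv

end StackInstr

/-! ### Stack operations on the two data counters -/

namespace StackInstr

open GraphInstr

variable {Q : Type} {K V : ℕ} {M : Q → StackInstr Q} {q q' q'' : Q}

/-- The counter on the given side. -/
def side (s : Bool) : Fin 3 := if s then 1 else 0

/-- Counter contents with `A` on side `s`, `B` on the other side and an empty auxiliary counter. -/
def contents (s : Bool) (A B : ℕ) : Fin 3 → ℕ := if s then ![B, A, 0] else ![A, B, 0]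

theorem contents_not (s : Bool) (A B : ℕ) : contents (!s) A B = contents s B A := by
  cases s <;> rfl

theorem side_ne (s : Bool) : side s ≠ 2 := by cases s <;> decide

theorem contents_two (s : Bool) (A B : ℕ) : contents s A B 2 = 0 := by cases s <;> rfl

theorem contents_side (s : Bool) (A B : ℕ) : contents s A B (side s) = A := by cases s <;> rfl

theorem update_contents (s : Bool) (A B A' : ℕ) :
    Function.update (contents s A B) (side s) A' = contents s A' B := by
  funext i
  cases s <;> fin_cases i <;> simp [contents, side]

theorem contents_le {s : Bool} {A B : ℕ} (hA : A ≤ V) (hB : B ≤ V) (i : Fin 3) :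
    contents s A B i ≤ V := by
  cases s <;> fin_cases i <;> simp [contents, hA, hB]

/-- Reachability between stack configurations, with all counter values bounded by `V`. -/
def StackReaches (K V : ℕ) (M : Q → StackInstr Q) (q : Q) (v : Fin 3 → ℕ) (q' : Q)
    (v' : Fin 3 → ℕ) : Prop :=
  Reaches (step (expand K M)) (bounded _ V) ((q, .start, 0), v) ((q', .start, 0), v')

theorem StackReaches.refl {v : Fin 3 → ℕ} (hv : ∀ i, v i ≤ V) : StackReaches K V M q v q v :=
  Reaches.refl hv

theorem StackReaches.trans {v v' v'' : Fin 3 → ℕ} (h : StackReaches K V M q v q' v')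
    (h' : StackReaches K V M q' v' q'' v'') : StackReaches K V M q v q'' v'' :=
  Reaches.trans h h'

variable {s : Bool} {A B : ℕ}

theorem stackReaches_push {k d : ℕ} (hM : M q = .push (side s) k d q') (hk : k ≤ K) (hd : d ≤ K)
    (hA : A ≤ V) (hB : B ≤ V) (hV : k * A + d ≤ V) :
    StackReaches K V M q (contents s A B) q' (contents s (k * A + d) B) := by
  have := reaches_push (K := K) (v := contents s A B) (V := V) hM (side_ne s) hk hd
    (contents_two s A B) (contents_le hA hB) (by rwa [contents_side])
  rwa [update_contents, contents_side] at this

theorem stackReaches_pop {k : ℕ} {next : ℕ → Q} (hM : M q = .pop (side s) k next) (hk : k ≤ K)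
    (hk0 : 0 < k) (hA : A ≤ V) (hB : B ≤ V) :
    StackReaches K V M q (contents s A B) (next (A % k)) (contents s (A / k) B) := by
  have := reaches_pop (K := K) (v := contents s A B) (V := V) hM (side_ne s) hk hk0
    (contents_two s A B) (contents_le hA hB)
  rwa [update_contents, contents_side] at this

theorem stackReaches_test {z : Q} (hM : M q = .test (side s) z q') (hA : A ≤ V) (hB : B ≤ V) :
    StackReaches K V M q (contents s A B) (if A = 0 then z else q') (contents s A B) := by
  have := reaches_test (K := K) (v := contents s A B) (V := V) hM (contents_le hA hB)
  rwa [contents_side] at this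

end StackInstr

/-! ### Digits -/

def digit (K n j : ℕ) : ℕ := n / K ^ j % K

theorem digit_zero (K n : ℕ) : digit K n 0 = n % K := by simp [digit]

theorem digit_div (K n j : ℕ) : digit K (n / K) j = digit K n (j + 1) := by
  rw [digit, digit, Nat.div_div_eq_div_mul, pow_succ']

theorem push_div {K d : ℕ} (hd : d < K) (n : ℕ) : (K * n + d) / K = n := by
  rw [Nat.mul_add_div (by omega), Nat.div_eq_of_lt hd, Nat.add_zero]

theorem push_mod {K d : ℕ} (hd : d < K) (n : ℕ) : (K * n + d) % K = d := by
  rw [Nat.mul_add_mod, Nat.mod_eq_of_lt hd]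

theorem digit_push_succ {K d : ℕ} (hd : d < K) (n j : ℕ) :
    digit K (K * n + d) (j + 1) = digit K n j := by
  rw [← digit_div, push_div hd]

/-- Equal digits are inherited by the quotients. The number zero is treated separately because
division by `K` does not decrease it. -/
theorem eq_of_digit_eq {K : ℕ} (hK : 2 ≤ K) {m n : ℕ} (h : ∀ j, digit K m j = digit K n j) :
    m = n := by
  induction m using Nat.strong_induction_on generalizing n with
  | _ m ih =>
    have h0 := h 0
    rw [digit_zero, digit_zero] at h0
    have hdiv : ∀ j, digit K (m / K) j = digit K (n / K) j := fun j => by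
      rw [digit_div, digit_div]; exact h _
    have hm := Nat.div_add_mod m K
    have hn := Nat.div_add_mod n K
    rcases Nat.eq_zero_or_pos m with rfl | hpos
    · have hz : ∀ n, (∀ j, digit K n j = 0) → n = 0 := by
        intro n
        induction n using Nat.strong_induction_on with
        | _ n ih' =>
          intro hd
          by_contra hne
          have h1 := ih' (n / K) (Nat.div_lt_self (by omega) (by omega))
            fun j => by rw [digit_div]; exact hd _
          have h2 := hd 0
          rw [digit_zero] at h2
          have := Nat.div_add_mod n K
          rw [h1, h2] at this
          omega
      refine (hz n fun j => ?_).symm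
      rw [← h j]
      simp [digit]
    · have := ih (m / K) (Nat.div_lt_self hpos (by omega)) hdiv
      rw [← hm, ← hn, this, h0]

theorem lt_pow_of_digit_eq_zero {K : ℕ} (hK : 2 ≤ K) {n m : ℕ}
    (h : ∀ j, m ≤ j → digit K n j = 0) : n < K ^ m := by
  have : n / K ^ m = 0 := by
    refine eq_of_digit_eq hK fun j => ?_
    have := h (m + j) (by omega)
    rw [digit, pow_add, ← Nat.div_div_eq_div_mul] at this
    rw [digit, this]
    simp [digit]
  exact (Nat.div_eq_zero_iff.mp this).resolve_left (by positivity)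

section Encode

variable {Γ : Type} (code : Γ → ℕ) (K : ℕ)

/-- The stack with the symbols `l` (topmost first) on top of the stack `n`. -/
def encode (l : List Γ) (n : ℕ) : ℕ := l.foldr (fun s n => K * n + code s) n

@[simp] theorem encode_nil (n : ℕ) : encode code K [] n = n := rfl

@[simp] theorem encode_cons (s : Γ) (l : List Γ) (n : ℕ) :
    encode code K (s :: l) n = K * encode code K l n + code s := rfl

theorem encode_append (l l' : List Γ) (n : ℕ) :
    encode code K (l ++ l') n = encode code K l (encode code K l' n) := by
  simp [encode]

variable {code K}

theorem push_lt {n d W : ℕ} (hd : d < K) (hn : n < W) : K * n + d < K * W :=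
  calc K * n + d < K * n + K := by omega
    _ = K * (n + 1) := by ring
    _ ≤ K * W := Nat.mul_le_mul_left _ hn

theorem encode_lt (hcode : ∀ s, code s < K) (l : List Γ) (n : ℕ) :
    encode code K l n < (n + 1) * K ^ l.length := by
  induction l with
  | nil => simp
  | cons s l ih =>
    have := push_lt (hcode s) ih
    rw [encode_cons, List.length_cons, pow_succ]
    calc _ < _ := this
      _ = _ := by ring

/-- Since `b` has code `0`, the zero digits above the word match the default value of `getD`. -/
theorem digit_encode (hcode : ∀ s, code s < K) {b : Γ} (hb : code b = 0) (l : List Γ) (j : ℕ) :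
    digit K (encode code K l 0) j = code (l.getD j b) := by
  induction l generalizing j with
  | nil => simp [digit, hb]
  | cons s l ih =>
    cases j with
    | zero => simp [digit_zero, Nat.mod_eq_of_lt (hcode s)]
    | succ j => simp [digit_push_succ (hcode s), ih]

end Encode

/-! ### Simulating a Turing machine on a three counter machine -/

namespace TuringToCounter

open StackInstr

instance : Fintype HeadMove :=
  ⟨⟨([.left, .stay, .right] : List HeadMove), by simp⟩, fun x => by cases x <;> simp⟩

instance (M : TuringMachine) : Nonempty M.Symbol := ⟨M.base .blank⟩

/-- The states up to `pushBlank` convert the input, those from `sim` to `pushRight` carry out Turing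
steps, and the remaining ones convert the output. -/
inductive SimState (σ Γ : Type) : Type
  | mark
  | testBits (s : Bool)
  | popBits (s : Bool)
  | pushBits (s b : Bool)
  | popBack
  | pushBack (a : Γ)
  | pushSep
  | pushBlank
  | sim (q : σ)
  | write (q : σ) (a : Γ) (d : HeadMove)
  | popLeft (q : σ)
  | pushRight (q : σ) (a : Γ)
  | readOut
  | outBit (b : Bool)
  | fin
  deriving Fintype

/-- The base symbol of a bit, as a tape symbol. -/
abbrev bitSym (M : TuringMachine) (b : Bool) : M.Symbol := M.base (if b then .one else .zero)

open Classical in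
/-- The stack program that simulates `M`. First the counters are converted from base `2` to base
`K`, then counter `0` holds the tape to the left of the head and counter `1` the rest of it. -/
noncomputable def instr (M : TuringMachine) (code : M.Symbol → ℕ) (K : ℕ) :
    SimState M.State M.Symbol → StackInstr (SimState M.State M.Symbol) :=
  fun
  | .mark => .push (side false) K (code (M.base .sep)) (.testBits true)
  | .testBits s => .test (side s) (if s then .popBack else .pushBlank) (.popBits s)
  | .popBits s => .pop (side s) 2 fun d => .pushBits s (d == 1)
  | .pushBits s b => .push (side (!s)) K (code (bitSym M b)) (.testBits s)
  | .popBack => .pop (side false) K fun d =>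
      if d = code (M.base .sep) then .pushSep else .pushBack (Function.invFun code d)
  | .pushBack a => .push (side true) K (code a) .popBack
  | .pushSep => .push (side true) K (code (M.base .sep)) (.testBits false)
  | .pushBlank => .push (side true) K (code (M.base .blank)) (.sim M.start)
  | .sim q => .pop (side true) K fun d =>
      match M.transition q (Function.invFun code d) with
      | some (q', a, m) => .write q' a m
      | none => .readOut
  | .write q a .left => .push (side true) K (code a) (.popLeft q)
  | .write q a .stay => .push (side true) K (code a) (.sim q)
  | .write q a .right => .push (side false) K (code a) (.sim q)
  | .popLeft q => .pop (side false) K fun d => .pushRight q (Function.invFun code d)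
  | .pushRight q a => .push (side true) K (code a) (.sim q)
  | .readOut => .pop (side true) K fun d =>
      if d = code (bitSym M false) then .outBit false
      else if d = code (bitSym M true) then .outBit true
      else .fin
  | .outBit b => .push (side false) 2 b.toNat .readOut
  | .fin => .halt

variable {M : TuringMachine} {code : M.Symbol → ℕ} {K V : ℕ}

theorem invFun_code (hinj : Function.Injective code) (a : M.Symbol) :
    Function.invFun code (code a) = a := Function.leftInverse_invFun hinj a

/-- The bits of the number on side `s` are moved to the other side. -/
theorem reaches_bits (hK : 2 ≤ K) (hcode : ∀ a, code a < K) (s : Bool) (n A : ℕ) (hn : n ≤ V)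
    (hV : (A + 1) * K ^ n.bits.length ≤ V) :
    StackReaches K V (instr M code K) (.testBits s) (contents s n A)
      (if s then .popBack else .pushBlank)
      (contents s 0 (encode code K (n.bits.map (bitSym M)).reverse A)) := by
  induction n using Nat.strong_induction_on generalizing A with
  | _ n ih =>
    have hA : A ≤ V := by
      have : A + 1 ≤ (A + 1) * K ^ n.bits.length := Nat.le_mul_of_pos_right _ (by positivity)
      omega
    have htest := stackReaches_test (K := K) (M := instr M code K) (q := .testBits s) (s := s)
      rfl hn hA
    rcases eq_or_ne n 0 with rfl | hne
    · simpa using htest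
    · rw [if_neg hne] at htest
      set b := n % 2 == 1 with hb
      rw [bits_eq_cons hne, List.length_cons, pow_succ] at hV
      have hpush := push_lt (hcode (bitSym M b)) (Nat.lt_add_one A)
      have hpow : 1 ≤ K ^ (n / 2).bits.length := Nat.one_le_pow _ _ (by omega)
      have hKA : K * (A + 1) ≤ V := by
        calc K * (A + 1) ≤ K * (A + 1) * K ^ (n / 2).bits.length := Nat.le_mul_of_pos_right _ hpow
          _ = _ := by ring
          _ ≤ V := hV
      have hn2 : n / 2 ≤ V := (Nat.div_le_self _ _).trans hn
      have h2 := stackReaches_pop (K := K) (M := instr M code K) (q := .popBits s) (s := s)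
        (A := n) (B := A) rfl hK (by omega) hn hA
      have h3 := stackReaches_push (K := K) (V := V) (M := instr M code K) (q := .pushBits s b)
        (s := !s) (A := A) (B := n / 2) rfl le_rfl (hcode _).le hA hn2
        (by omega)
      rw [contents_not, contents_not] at h3
      have h4 := ih (n / 2) (by omega) (K * A + code (bitSym M b)) hn2 (by
        calc _ ≤ K * (A + 1) * K ^ (n / 2).bits.length := Nat.mul_le_mul_right _ hpush
          _ = _ := by ring
          _ ≤ V := hV)
      rw [bits_eq_cons hne, List.map_cons, List.reverse_cons, encode_append]
      exact htest.trans (h2.trans (h3.trans h4))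

/-- The symbols above the mark are moved back. -/
theorem reaches_popBack (hinj : Function.Injective code) (hcode : ∀ a, code a < K)
    (l : List M.Symbol) (hl : ∀ a ∈ l, a ≠ M.base .sep) (x B : ℕ)
    (hA : encode code K l (K * x + code (M.base .sep)) ≤ V) (hB : (B + 1) * K ^ l.length ≤ V) :
    StackReaches K V (instr M code K) .popBack
      (contents false (encode code K l (K * x + code (M.base .sep))) B)
      .pushSep (contents false x (encode code K l.reverse B)) := by
  have hK0 : 0 < K := (Nat.zero_le _).trans_lt (hcode (M.base .sep))
  induction l generalizing B with
  | nil =>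
    have := stackReaches_pop (K := K) (V := V) (M := instr M code K) (q := .popBack) (s := false)
      (A := K * x + code (M.base .sep)) (B := B) rfl le_rfl hK0 hA (by simp at hB; omega)
    rw [push_mod (hcode _), push_div (hcode _), if_pos rfl] at this
    exact this
  | cons a l ih =>
    have hpow : 1 ≤ K ^ l.length := Nat.one_le_pow _ _ hK0
    rw [List.length_cons, pow_succ] at hB
    have hpush := push_lt (hcode a) (Nat.lt_add_one B)
    have hKB : K * (B + 1) ≤ V := by
      calc K * (B + 1) ≤ K * (B + 1) * K ^ l.length := Nat.le_mul_of_pos_right _ hpow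
        _ = _ := by ring
        _ ≤ V := hB
    have hBV : B ≤ V := (Nat.le_mul_of_pos_left _ hK0).trans ((Nat.mul_le_mul_left K
      (Nat.le_succ B)).trans hKB)
    have h1 := stackReaches_pop (K := K) (V := V) (M := instr M code K) (q := .popBack)
      (s := false) (A := encode code K (a :: l) (K * x + code (M.base .sep))) (B := B) rfl le_rfl
      hK0 hA hBV
    have hne : code a ≠ code (M.base .sep) := fun h => hl a (by simp) (hinj h)
    have hle : encode code K l (K * x + code (M.base .sep)) ≤ V := by
      refine le_trans ?_ hA
      rw [encode_cons]
      exact (Nat.le_mul_of_pos_left _ hK0).trans (Nat.le_add_right _ _)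
    rw [encode_cons, push_mod (hcode _), push_div (hcode _), if_neg hne, invFun_code hinj] at h1
    have h2 := stackReaches_push (K := K) (V := V) (M := instr M code K) (q := .pushBack a)
      (s := true) (A := B) (B := encode code K l (K * x + code (M.base .sep))) rfl le_rfl
      (hcode _).le hBV hle (by omega)
    rw [← Bool.not_false, contents_not, contents_not] at h2
    have h3 := ih (fun a ha => hl a (by simp [ha])) (K * B + code a) hle (by
      calc _ ≤ K * (B + 1) * K ^ l.length := Nat.mul_le_mul_right _ hpush
        _ = _ := by ring
        _ ≤ V := hB)
    rw [encode_cons, List.reverse_cons, encode_append]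
    exact h1.trans (h2.trans h3)

theorem map_base_pairInput (x y : ℕ) : (pairInput x y).map M.base =
    (x.bits.map (bitSym M)).reverse ++ M.base .sep :: y.bits.map (bitSym M) := by
  simp [pairInput, bin, Function.comp_def]

/-- The conversion of the input. -/
theorem reaches_input (hinj : Function.Injective code) (hcode : ∀ a, code a < K) (hK : 2 ≤ K)
    (hblank : code (M.base .blank) = 0) (x y : ℕ) (hV : K ^ ((pairInput x y).length + 1) ≤ V) :
    StackReaches K V (instr M code K) .mark (contents false x y) (.sim M.start)
      (contents false 0 (K * encode code K ((pairInput x y).map M.base) 0)) := by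
  have hlen := CounterToTuring.length_pairInput x y
  have hpow {j : ℕ} (h : j ≤ (pairInput x y).length + 1) : K ^ j ≤ V :=
    (Nat.pow_le_pow_right (by omega) h).trans hV
  have hlt (n : ℕ) : n < K ^ n.bits.length := by
    have : n < 2 ^ n.bits.length := by
      rw [Nat.size_eq_bits_len]; exact Nat.lt_size_self n
    exact this.trans_le (Nat.pow_le_pow_left hK _)
  have hx : x ≤ V := (hlt x).le.trans (hpow (by omega))
  have hy : y ≤ V := (hlt y).le.trans (hpow (by omega))
  have hmark : K * x + code (M.base .sep) < K ^ (x.bits.length + 1) := by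
    rw [pow_succ']; exact push_lt (hcode _) (hlt x)
  -- The number `x` is not written in base `K` symbols yet; the separator pushed on top of it marks
  -- where the symbols of `y` will end.
  have h1 := stackReaches_push (K := K) (V := V) (M := instr M code K) (q := .mark) (s := false)
    (A := x) (B := y) rfl le_rfl (hcode _).le hx hy (hmark.le.trans (hpow (by omega)))
  have hbd : (K * x + code (M.base .sep) + 1) * K ^ y.bits.length ≤ V := by
    refine (Nat.mul_le_mul_right _ hmark).trans ?_
    rw [← pow_add]
    exact hpow (by omega)
  have h2 := reaches_bits (M := M) hK hcode true y (K * x + code (M.base .sep)) hy hbd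
  rw [← Bool.not_false, contents_not, contents_not] at h2
  have hle : encode code K (y.bits.map (bitSym M)).reverse (K * x + code (M.base .sep)) ≤ V := by
    refine (encode_lt hcode _ _).le.trans ?_
    simpa using hbd
  -- Moving the bits of `y` to the other counter reversed them; moving them back in base `K`
  -- restores their order.
  have h3 := reaches_popBack (M := M) hinj hcode (V := V) (y.bits.map (bitSym M)).reverse (by
      intro a ha h
      simp only [List.mem_reverse, List.mem_map] at ha
      obtain ⟨b, -, rfl⟩ := ha
      have := M.base.injective h
      cases b <;> simp at this) x 0 hle (by simpa using hpow (by omega))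
  rw [List.reverse_reverse] at h3
  have hY : encode code K (y.bits.map (bitSym M)) 0 < K ^ y.bits.length := by
    simpa using encode_lt hcode (y.bits.map (bitSym M)) 0
  have hsep : encode code K (M.base .sep :: y.bits.map (bitSym M)) 0 < K ^ (y.bits.length + 1) := by
    rw [pow_succ']; exact push_lt (hcode _) hY
  have h4 := stackReaches_push (K := K) (V := V) (M := instr M code K) (q := .pushSep) (s := true)
    (A := encode code K (y.bits.map (bitSym M)) 0) (B := x) rfl le_rfl (hcode _).le
    (hY.le.trans (hpow (by omega))) hx (hsep.le.trans (hpow (by omega)))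
  rw [← Bool.not_false, contents_not, contents_not] at h4
  -- The bits of `x` are moved least significant first, so the most significant one ends on top, as
  -- the word requires.
  have h5 := reaches_bits (M := M) hK hcode false x
    (encode code K (M.base .sep :: y.bits.map (bitSym M)) 0) hx (by
      refine (Nat.mul_le_mul_right _ hsep).trans ?_
      rw [← pow_add]
      exact hpow (by omega))
  rw [← encode_append, ← map_base_pairInput] at h5
  have hw : encode code K ((pairInput x y).map M.base) 0 < K ^ (pairInput x y).length := by
    simpa using encode_lt hcode ((pairInput x y).map M.base) 0
  have hw' := push_lt (hcode (M.base .blank)) hw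
  rw [← pow_succ'] at hw'
  have h6 := stackReaches_push (K := K) (V := V) (M := instr M code K) (q := .pushBlank)
    (s := true) (A := encode code K ((pairInput x y).map M.base) 0) (B := 0) rfl le_rfl
    (hcode _).le (hw.le.trans (hpow (by omega))) (Nat.zero_le _) (hw'.le.trans hV)
  rw [← Bool.not_false, contents_not, contents_not, hblank] at h6
  exact h1.trans (h2.trans (h3.trans (h4.trans (h5.trans h6))))

/-- The output is read off the right part of the tape. -/
theorem reaches_readOut (hinj : Function.Injective code) (hcode : ∀ a, code a < K) (hK : 2 ≤ K)
    (hblank : code (M.base .blank) = 0) (l : List Bool) (A : ℕ)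
    (hA : (A + 1) * 2 ^ l.length ≤ V) (hB : encode code K (l.map (bitSym M)) 0 ≤ V) :
    StackReaches K V (instr M code K) .readOut
      (contents false A (encode code K (l.map (bitSym M)) 0)) .fin
      (contents false (l.foldl (fun n b => 2 * n + b.toNat) A) 0) := by
  have hne {a b : BaseSymbol} (h : a ≠ b) : code (M.base a) ≠ code (M.base b) := fun e =>
    h (M.base.injective (hinj e))
  have hAV : A ≤ V := by
    have : A + 1 ≤ (A + 1) * 2 ^ l.length := Nat.le_mul_of_pos_right _ (by positivity)
    omega
  have h1 := stackReaches_pop (K := K) (V := V) (M := instr M code K) (q := .readOut) (s := true)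
      (A := encode code K (l.map (bitSym M)) 0) (B := A) rfl le_rfl (by omega) hB hAV
  rw [← Bool.not_false, contents_not, contents_not] at h1
  induction l generalizing A with
  | nil =>
    simp only [List.map_nil, encode_nil, Nat.zero_mod, Nat.zero_div] at h1
    -- Popping the empty stack gives the digit `0`, the code of the blank, which ends the output.
    rw [← hblank, if_neg (hne (by simp)), if_neg (hne (by simp)), hblank] at h1
    exact h1
  | cons b l ih =>
    rw [List.map_cons, encode_cons] at hB
    rw [List.length_cons, pow_succ] at hA
    have hpow : 1 ≤ 2 ^ l.length := Nat.one_le_two_pow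
    have hle : encode code K (l.map (bitSym M)) 0 ≤ V :=
      ((Nat.le_mul_of_pos_left _ (by omega)).trans (Nat.le_add_right _ _)).trans hB
    have hlt : b.toNat < 2 := by cases b <;> simp
    have hpush : 2 * A + b.toNat < 2 * (A + 1) := push_lt hlt (Nat.lt_succ_self A)
    have hA' : (2 * A + b.toNat + 1) * 2 ^ l.length ≤ V := by
      calc _ ≤ 2 * (A + 1) * 2 ^ l.length := Nat.mul_le_mul_right _ hpush
        _ = _ := by ring
        _ ≤ V := hA
    have hAV' : 2 * A + b.toNat ≤ V := by
      have : 2 * A + b.toNat + 1 ≤ (2 * A + b.toNat + 1) * 2 ^ l.length :=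
        Nat.le_mul_of_pos_right _ (by positivity)
      omega
    rw [List.map_cons, encode_cons, push_mod (hcode _), push_div (hcode _)] at h1
    have hnext : (if code (bitSym M b) = code (bitSym M false) then SimState.outBit false
        else if code (bitSym M b) = code (bitSym M true) then SimState.outBit true
        else (SimState.fin : SimState M.State M.Symbol)) = .outBit b := by
      cases b
      · simp
      · rw [if_neg (hne (by simp)), if_pos rfl]
    have h1' : StackReaches K V (instr M code K) .readOut
        (contents false A (K * encode code K (l.map (bitSym M)) 0 + code (bitSym M b))) (.outBit b)
        (contents false A (encode code K (l.map (bitSym M)) 0)) := by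
      rw [← hnext]
      exact h1
    have h2 := stackReaches_push (K := K) (V := V) (M := instr M code K) (q := .outBit b)
      (s := false) (A := A) (B := encode code K (l.map (bitSym M)) 0) rfl hK (by omega)
      hAV hle hAV'
    have h3 := stackReaches_pop (K := K) (V := V) (M := instr M code K) (q := .readOut)
      (s := true) (A := encode code K (l.map (bitSym M)) 0) (B := 2 * A + b.toNat) rfl le_rfl
      (by omega) hle hAV'
    rw [← Bool.not_false, contents_not, contents_not] at h3
    exact h1'.trans (h2.trans (ih _ hA' hle hAV' h3))

/-! ### The tape as a pair of numbers -/

/-- `A` and `B` encode the tape of `c` to the left and to the right of the head. -/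
def Encodes (code : M.Symbol → ℕ) (K : ℕ) (c : M.Config) (A B : ℕ) : Prop :=
  (∀ j : ℕ, digit K A j = code (c.tape (c.head - 1 - j))) ∧
    ∀ j : ℕ, digit K B j = code (c.tape (c.head + j))

/-- The configurations with head and non-blank cells at distance at most `D` from cell `0`. -/
def within (M : TuringMachine) (D : ℕ) : Set M.Config :=
  {c | |c.head| ≤ D ∧ ∀ z : ℤ, D < |z| → c.tape z = M.base .blank}

/-- Non-blank cells lie in a window of `2 * D + 1` cells around cell `0` that contains the head, and
all other digits are zero. -/
theorem Encodes.lt (hK : 2 ≤ K) (hblank : code (M.base .blank) = 0) {c : M.Config} {D A B : ℕ}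
    (hc : c ∈ within M D) (h : Encodes code K c A B) :
    A < K ^ (2 * D + 1) ∧ B < K ^ (2 * D + 1) := by
  obtain ⟨hh, ht⟩ := hc
  rw [abs_le] at hh
  constructor <;> refine lt_pow_of_digit_eq_zero hK fun j hj => ?_
  · rw [h.1, ht _ (by rw [lt_abs]; omega), hblank]
  · rw [h.2, ht _ (by rw [lt_abs]; omega), hblank]

theorem Encodes.step (hinj : Function.Injective code) (hcode : ∀ a, code a < K) (hK : 2 ≤ K)
    (hblank : code (M.base .blank) = 0) {c : M.Config} {D A B : ℕ}
    (hc : c ∈ within M D) (h : Encodes code K c A B) :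
    ∃ A' B', Encodes code K (M.step c) A' B' ∧
      StackReaches K (K ^ (2 * D + 3)) (instr M code K) (.sim c.state) (contents false A B)
        (.sim (M.step c).state) (contents false A' B') := by
  obtain ⟨hA, hB⟩ := h.lt hK hblank hc
  obtain ⟨hl, hr⟩ := h
  set W := K ^ (2 * D + 1) with hW
  -- A left move pushes two symbols on the right stack, the written one and the one to the left of
  -- the head; this accounts for the two extra factors `K`.
  have hV : K ^ (2 * D + 3) = K * (K * W) := by rw [hW]; ring
  have hWK : W ≤ K * W := Nat.le_mul_of_pos_left _ (by omega)
  have hWKK : K * W ≤ K * (K * W) := Nat.le_mul_of_pos_left _ (by omega)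
  rw [hV]
  have hBK : B / K < W := (Nat.div_le_self _ _).trans_lt hB
  rcases htr : M.transition c.state (c.tape c.head) with _ | ⟨q', a, m⟩
  · have hs : M.step c = c := by simp [TuringMachine.step, htr]
    rw [hs]
    exact ⟨A, B, ⟨hl, hr⟩, StackReaches.refl (contents_le (by omega) (by omega))⟩
  · have hs : M.step c = ⟨q', c.head + m.offset, Function.update c.tape c.head a⟩ := by
      simp [TuringMachine.step, htr]
    have h1 := stackReaches_pop (K := K) (V := K * (K * W)) (M := instr M code K)
      (q := .sim c.state) (s := true) (A := B) (B := A) rfl le_rfl (by omega) (by omega) (by omega)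
    have hB0 : B % K = code (c.tape c.head) := by
      rw [← digit_zero, hr 0]; simp
    rw [hB0, invFun_code hinj, htr, ← Bool.not_false, contents_not, contents_not] at h1
    have hr' (j : ℕ) : digit K (B / K) j = code (c.tape (c.head + (j + 1))) := by
      rw [digit_div, hr]; push_cast; rfl
    have hpB := push_lt (hcode a) hBK
    rw [hs]
    cases m with
    | left =>
      have h2 := stackReaches_push (K := K) (V := K * (K * W)) (M := instr M code K)
        (q := .write q' a .left) (s := true) (A := B / K) (B := A) rfl le_rfl (hcode _).le
        (by omega) (by omega) (by omega)
      have h3 := stackReaches_pop (K := K) (V := K * (K * W)) (M := instr M code K)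
        (q := .popLeft q') (s := false) (A := A) (B := K * (B / K) + code a) rfl le_rfl (by omega)
        (by omega) (by omega)
      have hA0 : A % K = code (c.tape (c.head - 1)) := by
        rw [← digit_zero, hl 0]; simp
      rw [hA0, invFun_code hinj] at h3
      have hpB' := push_lt (hcode (c.tape (c.head - 1))) hpB
      have h4 := stackReaches_push (K := K) (V := K * (K * W)) (M := instr M code K)
        (q := .pushRight q' (c.tape (c.head - 1))) (s := true) (A := K * (B / K) + code a)
        (B := A / K) rfl le_rfl (hcode _).le (by omega)
        ((Nat.div_le_self _ _).trans (by omega)) hpB'.le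
      rw [← Bool.not_false, contents_not, contents_not] at h2 h4
      refine ⟨_, _, ⟨fun j => ?_, fun j => ?_⟩, h1.trans (h2.trans (h3.trans h4))⟩
      · simp only [HeadMove.offset]
        rw [digit_div, hl, Function.update_of_ne (by omega)]
        congr 2; push_cast; ring
      · simp only [HeadMove.offset]
        -- Digit `0` is the symbol fetched from the left, digit `1` the symbol just written, and the
        -- others are the old right part.
        rcases j with _ | _ | j
        · rw [digit_zero, push_mod (hcode _), Function.update_of_ne (by simp)]
          congr 2; push_cast; ring
        · rw [digit_push_succ (hcode _), digit_zero, push_mod (hcode _)]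
          rw [show c.head + -1 + ((0 + 1 : ℕ) : ℤ) = c.head by push_cast; ring,
            Function.update_self]
        · rw [digit_push_succ (hcode _), digit_push_succ (hcode _), hr',
            Function.update_of_ne (by push_cast; omega)]
          congr 2; push_cast; ring
    | stay =>
      have h2 := stackReaches_push (K := K) (V := K * (K * W)) (M := instr M code K)
        (q := .write q' a .stay) (s := true) (A := B / K) (B := A) rfl le_rfl (hcode _).le
        (by omega) (by omega) (by omega)
      rw [← Bool.not_false, contents_not, contents_not] at h2
      refine ⟨_, _, ⟨fun j => ?_, fun j => ?_⟩, h1.trans h2⟩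
      · simp only [HeadMove.offset, add_zero]
        rw [hl, Function.update_of_ne (by omega)]
      · simp only [HeadMove.offset, add_zero]
        cases j with
        | zero => rw [digit_zero, push_mod (hcode _)]; simp
        | succ j =>
          rw [digit_push_succ (hcode _), hr', Function.update_of_ne (by push_cast; omega)]
          push_cast; rfl
    | right =>
      have hpA := push_lt (hcode a) hA
      have h2 := stackReaches_push (K := K) (V := K * (K * W)) (M := instr M code K)
        (q := .write q' a .right) (s := false) (A := A) (B := B / K) rfl le_rfl (hcode _).le
        (by omega) (by omega) (by omega)
      refine ⟨_, _, ⟨fun j => ?_, fun j => ?_⟩, h1.trans h2⟩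
      · simp only [HeadMove.offset]
        cases j with
        | zero => rw [digit_zero, push_mod (hcode _)]; simp
        | succ j =>
          rw [digit_push_succ (hcode _), hl, Function.update_of_ne (by push_cast; omega)]
          congr 2; push_cast; ring
      · simp only [HeadMove.offset]
        rw [hr', Function.update_of_ne (by omega)]
        congr 2; ring

/-- Only the cell under the head is rewritten, so a bound on the head positions alone also confines
the non-blank cells. -/
theorem step_mem_within {c : M.Config} {D : ℕ} (hc : c ∈ within M D)
    (hh : |(M.step c).head| ≤ D) : M.step c ∈ within M D := by
  refine ⟨hh, fun z hz => ?_⟩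
  obtain ⟨hh', ht⟩ := hc
  unfold TuringMachine.step
  split
  · have : z ≠ c.head := by rintro rfl; omega
    simpa [this] using ht z hz
  · exact ht z hz

theorem init_mem_within (w : List BaseSymbol) {D : ℕ} (hD : w.length ≤ D) :
    M.init w ∈ within M D := by
  refine ⟨by simp [TuringMachine.init], fun z hz => ?_⟩
  simp only [TuringMachine.init, TuringMachine.tapeOf]
  split_ifs with h
  · rw [abs_of_pos h] at hz
    rw [List.getD_eq_default _ _ (by omega)]
  · rfl

theorem encodes_init (hcode : ∀ a, code a < K)
    (hblank : code (M.base .blank) = 0) (w : List BaseSymbol) :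
    Encodes code K (M.init w) 0 (K * encode code K (w.map M.base) 0) := by
  have hK0 : 0 < K := (Nat.zero_le _).trans_lt (hcode (M.base .sep))
  constructor
  · intro j
    have : ¬ (0 : ℤ) < 0 - 1 - j := by omega
    simp only [TuringMachine.init, TuringMachine.tapeOf, if_neg this, hblank]
    simp [digit]
  · intro j
    cases j with
    | zero => simp [TuringMachine.init, TuringMachine.tapeOf, hblank, digit_zero]
    | succ j =>
      have := digit_push_succ hK0 (encode code K (w.map M.base) 0) j
      rw [Nat.add_zero] at this
      rw [this, digit_encode hcode hblank, List.getD_map]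
      have h1 : (0 : ℤ) < 0 + ((j + 1 : ℕ) : ℤ) := by omega
      have h2 : (0 + ((j + 1 : ℕ) : ℤ) - 0 - 1).toNat = j := by omega
      simp only [TuringMachine.init, TuringMachine.tapeOf, if_pos h1, h2]

/-- The complete simulation. -/
theorem reaches_fin (hinj : Function.Injective code) (hcode : ∀ a, code a < K) (hK : 2 ≤ K)
    (hblank : code (M.base .blank) = 0) {x y n t D : ℕ} (hD : (pairInput x y).length ≤ D)
    (hspace : ∀ s, |(M.step^[s] (M.init (pairInput x y))).head| ≤ D)
    (hhalt : M.Halted (M.step^[t] (M.init (pairInput x y))))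
    (htape : (M.step^[t] (M.init (pairInput x y))).tape =
      M.tapeOf (M.step^[t] (M.init (pairInput x y))).head (bin n)) :
    StackReaches K (K ^ (2 * D + 3)) (instr M code K) .mark (contents false x y) .fin
      (contents false n 0) := by
  have hpow {j : ℕ} (h : j ≤ 2 * D + 3) : K ^ j ≤ K ^ (2 * D + 3) :=
    Nat.pow_le_pow_right (by omega) h
  have h1 := reaches_input (M := M) hinj hcode hK hblank x y (hpow (by omega))
  have hmem (s : ℕ) : M.step^[s] (M.init (pairInput x y)) ∈ within M D := by
    induction s with
    | zero => exact init_mem_within _ hD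
    | succ s ih =>
      have := hspace (s + 1)
      rw [Function.iterate_succ_apply'] at this ⊢
      exact step_mem_within ih this
  obtain ⟨_, ⟨A, B, hAB, rfl⟩, h2⟩ := Reaches.simulate
    (f := GraphInstr.step (expand K (instr M code K))) (S := GraphInstr.bounded _ (K ^ (2 * D + 3)))
    (g := M.step) (T := within M D)
    (R := fun c d => ∃ A B, Encodes code K c A B ∧
      d = ((.sim c.state, .start, 0), contents false A B))
    (fun c hc _ d ⟨A, B, hAB, hd⟩ => by
      obtain ⟨A', B', hAB', hr⟩ := hAB.step hinj hcode hK hblank hc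
      exact ⟨_, ⟨A', B', hAB', rfl⟩, hd ▸ hr⟩)
    (fun c hc d ⟨A, B, hAB, hd⟩ => by
      obtain ⟨hA, hB⟩ := hAB.lt hK hblank hc
      subst hd
      intro i
      exact contents_le (s := false) (hA.le.trans (hpow (by omega))) (hB.le.trans (hpow (by omega))) i)
    (x := M.init (pairInput x y)) ⟨t, rfl, fun s _ => hmem s⟩
    ⟨0, K * encode code K ((pairInput x y).map M.base) 0, encodes_init hcode hblank _, rfl⟩
  set c := M.step^[t] (M.init (pairInput x y)) with hc
  obtain ⟨hA, hB⟩ := hAB.lt hK hblank (hmem t)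
  obtain ⟨hl, hr⟩ := hAB
  have hA0 : A = 0 := by
    refine eq_of_digit_eq hK fun j => ?_
    have : ¬ c.head < c.head - 1 - j := by omega
    rw [hl, htape]
    simp only [TuringMachine.tapeOf, if_neg this, hblank]
    simp [digit]
  have hbin : (bin n).map M.base = n.bits.reverse.map (bitSym M) := by
    simp [bin, Function.comp_def]
  -- Division by `K` removes the blank on which the head stands before the output.
  have hB1 : B / K = encode code K (n.bits.reverse.map (bitSym M)) 0 := by
    refine eq_of_digit_eq hK fun j => ?_
    have h1 : c.head < c.head + ((j + 1 : ℕ) : ℤ) := by omega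
    have h2 : (c.head + ((j + 1 : ℕ) : ℤ) - c.head - 1).toNat = j := by omega
    rw [digit_div, hr, ← hbin, digit_encode hcode hblank, List.getD_map, htape]
    simp only [TuringMachine.tapeOf, if_pos h1, h2]
  have h3 := stackReaches_pop (K := K) (V := K ^ (2 * D + 3)) (M := instr M code K)
    (q := .sim c.state) (s := true) (A := B) (B := A) rfl le_rfl (by omega)
    (hB.le.trans (hpow (by omega))) (hA.le.trans (hpow (by omega)))
  have hB0 : B % K = code (c.tape c.head) := by
    rw [← digit_zero, hr 0]; simp
  unfold TuringMachine.Halted at hhalt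
  rw [hB0, invFun_code hinj, hhalt, ← Bool.not_false, contents_not, contents_not, hB1] at h3
  subst hA0
  -- A longer output would have its last symbol, which is not blank, outside the window. The bound
  -- keeps the output within `V`.
  have hlen : n.bits.length ≤ 2 * D := by
    by_contra hlt
    obtain ⟨hh, ht⟩ := hmem t
    rw [← hc] at hh ht
    rw [abs_le] at hh
    have hb := ht (c.head + n.bits.length) (by rw [lt_abs]; omega)
    have h1 : c.head < c.head + (n.bits.length : ℤ) := by omega
    have h2 : (c.head + (n.bits.length : ℤ) - c.head - 1).toNat = n.bits.length - 1 := by omega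
    rw [htape] at hb
    simp only [TuringMachine.tapeOf, if_pos h1, h2] at hb
    have hb' := M.base.injective hb
    have hlt' : n.bits.length - 1 < (bin n).length := by simp [bin]; omega
    rw [List.getD_eq_getElem _ _ hlt'] at hb'
    have hm : BaseSymbol.blank ∈ bin n := hb' ▸ List.getElem_mem hlt'
    simp only [bin, List.mem_reverse, List.mem_map] at hm
    obtain ⟨b, -, hb⟩ := hm
    cases b <;> simp at hb
  have h4 := reaches_readOut (M := M) (V := K ^ (2 * D + 3)) hinj hcode hK hblank n.bits.reverse 0
    (by
      rw [Nat.zero_add, one_mul, List.length_reverse]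
      exact (Nat.pow_le_pow_left hK _).trans (hpow (by omega)))
    (by
      rw [← hB1]
      exact (Nat.div_le_self _ _).trans (hB.le.trans (hpow (by omega))))
  have hval : n.bits.reverse.foldl (fun n b => 2 * n + b.toNat) 0 = n := by
    rw [List.foldl_reverse]
    exact bitsValue_bits n
  rw [hval] at h4
  exact h1.trans (StackReaches.trans h2 (h3.trans h4))

/-! ### Coding of symbols and the polynomial time bound -/

theorem exists_code (M : TuringMachine) : ∃ (K : ℕ) (code : M.Symbol → ℕ),
    2 ≤ K ∧ Function.Injective code ∧ (∀ a, code a < K) ∧ code (M.base .blank) = 0 := by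
  have := M.finiteSymbol
  classical
  let e := Finite.equivFin M.Symbol
  refine ⟨Nat.card M.Symbol + 2,
    fun a => if a = M.base .blank then 0 else (e a : ℕ) + 1, by omega, ?_, ?_, by simp⟩
  · intro a b h
    simp only at h
    split_ifs at h with h1 h2
    · rw [h1, h2]
    · exact e.injective (Fin.ext (by omega))
  · intro a
    simp only
    split_ifs <;> omega

/-- From `K ≤ 2 ^ K` it suffices to bound powers of `2`, and `2` to the length of the input word is
at most quadratic in `m`. -/
theorem pow_length_le (K m : ℕ) {x y : ℕ} (hx : x ≤ m) (hy : y ≤ m) (a b : ℕ) :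
    K ^ (a * (pairInput x y).length + b) ≤
      (2 * (2 * m + 1) ^ 2) ^ (K * a) * 2 ^ (K * b) := by
  have hn : 2 ^ (pairInput x y).length ≤ 2 * (2 * m + 1) ^ 2 := by
    rw [CounterToTuring.length_pairInput, pow_succ, pow_add]
    have h1 := (two_pow_length_bits_le x).trans (by omega : 2 * x + 1 ≤ 2 * m + 1)
    have h2 := (two_pow_length_bits_le y).trans (by omega : 2 * y + 1 ≤ 2 * m + 1)
    calc _ ≤ (2 * m + 1) * (2 * m + 1) * 2 := Nat.mul_le_mul_right _ (Nat.mul_le_mul h1 h2)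
      _ = _ := by ring
  calc K ^ (a * (pairInput x y).length + b)
      ≤ (2 ^ K) ^ (a * (pairInput x y).length + b) :=
        Nat.pow_le_pow_left Nat.lt_two_pow_self.le _
    _ = (2 ^ (pairInput x y).length) ^ (K * a) * 2 ^ (K * b) := by
        rw [← pow_mul, ← pow_mul, ← pow_add]
        congr 1
        ring
    _ ≤ _ := Nat.mul_le_mul_right _ (Nat.pow_le_pow_left hn _)

end TuringToCounter

open TuringToCounter StackInstr in
theorem ThreeCounterPolyTime.of_turingLinearSpace {f : ℕ → ℕ → ℕ} (hf : TuringLinearSpace f) :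
    ThreeCounterPolyTime f := by
  obtain ⟨M, c, hM⟩ := hf
  obtain ⟨K, code, hK, hinj, hcode, hblank⟩ := exists_code M
  have := M.finiteSymbol
  have := M.finiteState
  have := Fintype.ofFinite M.Symbol
  have := Fintype.ofFinite M.State
  let Q := SimState M.State M.Symbol × Phase × Fin (K + 1)
  let e : Q ≃ Fin (Nat.card Q) := Finite.equivFin Q
  let P := GraphInstr.compile e (expand K (instr M code K)) (.mark, .start, 0)
  -- This is the number of configurations `(2 * card Q + 1) * (V + 1) ^ 3`, with `V = K ^ (2 * D +
  -- 3)` replaced by its polynomial bound.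
  refine ⟨P, Polynomial.C (2 * Nat.card Q + 1) *
    ((2 * (2 * Polynomial.X + 1) ^ 2) ^ (K * (2 * (c + 1))) * Polynomial.C (2 ^ (K * 3)) + 1) ^ 3,
    fun x y => ?_⟩
  obtain ⟨⟨t, hhalt, htape⟩, hspace⟩ := hM x y
  -- Using `c + 1` instead of `c` makes the window contain the input word even if `c = 0`.
  have hD (s : ℕ) : |(M.step^[s] (M.init (pairInput x y))).head| ≤
      (((c + 1) * (pairInput x y).length : ℕ) : ℤ) := by
    refine (hspace s).trans ?_
    exact_mod_cast Nat.mul_le_mul_right _ (Nat.le_succ c)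
  have hr := reaches_fin hinj hcode hK hblank (Nat.le_mul_of_pos_left _ (Nat.succ_pos c)) hD
    hhalt htape
  obtain ⟨T, hT, hTh, hTv⟩ := GraphInstr.compile_halts (e := e) rfl hr
  refine ⟨T, hT.trans ?_, hTh, congrFun hTv 0⟩
  have hpow := pow_length_le K (max x y) (le_max_left x y) (le_max_right x y) (2 * (c + 1)) 3
  rw [mul_assoc] at hpow
  simp only [Polynomial.eval_mul, Polynomial.eval_C, Polynomial.eval_pow, Polynomial.eval_add,
    Polynomial.eval_one, Polynomial.eval_X, Polynomial.eval_ofNat]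
  gcongr

theorem theorem1 :
    {f : ℕ → ℕ → ℕ | ThreeCounterPolyTime f} = {f : ℕ → ℕ → ℕ | TuringLinearSpace f} := by
  ext f
  exact ⟨TuringLinearSpace.of_threeCounterPolyTime, ThreeCounterPolyTime.of_turingLinearSpace⟩
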